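/- Let $n,k,s,p,r$ be integers with $1\le r\le k$ and $r\le p\le s+r-1$, and put $q=(k-r)(s+1)+p$. Write $[m]=\{1,\dots,m\}$ and let $\binom{[n]}{k}$ be the family of all $k$-element subsets of $[n]$. Let $\mathcal F\subset\binom{[n]}{k}$ have property $U(s+1,q)$, that is, $|F_0\cup\dots\cup F_s|\le q$ for all (not necessarily distinct) $F_0,\dots,F_s\in\mathcal F$. If $$n\ge p+1+(s+f(s,p,r))(k-r),\qquad\text{where}\quad f(s,p,r)=s(s+1)\cdot\frac{\sum_{j=0}^{r-1}s^{r-1-j}\binom pj}{\binom pr},$$ then $$|\mathcal F|\le|\mathcal A_{p,r}|,\qquad\text{where}\quad \mathcal A_{p,r}=\Big\{A\in\binom{[n]}{k}:|A\cap[p]|\ge r\Big\}.$$ -/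

import Mathlib

namespace UnionFamilies

/-- The family `𝒜_{p,r}` of all `k`-element subsets `A` of `[n] = {1, …, n}` with
`|A ∩ [p]| ≥ r`. -/
def frankl (n k p r : ℕ) : Finset (Finset ℕ) :=
  (Finset.powersetCard k (Finset.Icc 1 n)).filter fun A => r ≤ (A ∩ Finset.Icc 1 p).card

/-- Property `U(m, q)`: any `m` members of the family, repetitions allowed, have a union of
size at most `q`. -/
def PropertyU (m q : ℕ) (F : Finset (Finset ℕ)) : Prop :=
  ∀ G : Fin m → Finset ℕ, (∀ i, G i ∈ F) → (Finset.univ.biUnion G).card ≤ q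

/-- `f(s,p,r) = s (s+1) · (∑_{j=0}^{r-1} s^{r-1-j} C(p,j)) / C(p,r)`. -/
noncomputable def f (s p r : ℕ) : ℝ :=
  (s : ℝ) * ((s : ℝ) + 1) *
    ((∑ j ∈ Finset.range r, (s : ℝ) ^ (r - 1 - j) * (p.choose j : ℝ)) / (p.choose r : ℝ))

end UnionFamilies

/-! Shifting preserves the size of F and the union property, so F may be taken shifted. Sets are
sorted by their trace on [p+1]. All heavy sets (`IsHeavy`) of F lie in 𝒜_{p,r}, so only the others
matter. In 𝒜_{p,r} the others are the sets whose trace is an r-subset of [p], C(p,r)·C(n-p-1,k-r) in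
number. In F there are also sets with fewer than r elements in [p], and these must be paid for by a
deficit among the former.

Low traces: if |Q| < r, then s+1 members containing Q and otherwise disjoint would have too large a
union. In a shifted family this forces the members of the link of Q to crowd towards its beginning,
so the link is at most s times its shadow (`card_le_mul_card_shadow`). That shadow lies in the link
of every Q ∪ {x}. Iterating, all low traces are bounded by the number b of sets with trace T ∪
{p+1}, |T| = r-1.

Deficit: for fixed T the links of T ∪ {x}, x ∈ [p+1] \ T, form a chain whose least member belongs to
x = p+1. Disjoint representatives would give a union of size q+1, so there are none. For such a
chain of l-subsets of an m-set, Σ_{i=1}^s |G_i| + u|G_0| ≤ s·C(m,l) whenever u ≥ s and m ≥ (s+u)l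
(`sum_card_add_mul_card_le`, by Katona's circle method). Summed over T with u = f(s,p,r), the
weighted term in b pays exactly for the bound on the low traces. -/

namespace UnionFamilies
open Finset

/-! ### Shifting and domination -/

/-- A family of sets of positive integers is shifted if replacing an element by a smaller one
does not lead out of the family. -/
def Shifted (F : Finset (Finset ℕ)) : Prop :=
  ∀ A ∈ F, ∀ i j, 1 ≤ i → i < j → j ∈ A → i ∉ A → insert i (A.erase j) ∈ F

/-- The action of the `(i, j)`-shift of the family `F` on a set `A`. -/
def shiftSet (F : Finset (Finset ℕ)) (i j : ℕ) (A : Finset ℕ) : Finset ℕ :=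
  if j ∈ A ∧ i ∉ A ∧ insert i (A.erase j) ∉ F then insert i (A.erase j) else A

theorem insert_erase_insert_erase {i j : ℕ} {A : Finset ℕ} (hj : j ∈ A) (hi : i ∉ A) :
    insert j ((insert i (A.erase j)).erase i) = A := by
  rw [erase_insert (by simp [hi]), insert_erase hj]

theorem shiftSet_injOn (F : Finset (Finset ℕ)) (i j : ℕ) :
    Set.InjOn (shiftSet F i j) (F : Set (Finset ℕ)) := by
  intro A hA B hB h
  simp only [mem_coe] at hA hB
  unfold shiftSet at h
  split_ifs at h with h1 h2 h2
  · rw [← insert_erase_insert_erase h1.1 h1.2.1, h, insert_erase_insert_erase h2.1 h2.2.1]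
  · exact absurd (h ▸ hB) h1.2.2
  · exact absurd (h ▸ hA) h2.2.2
  · exact h

theorem card_insert_erase {i j : ℕ} {A : Finset ℕ} (hj : j ∈ A) (hi : i ∉ A) :
    (insert i (A.erase j)).card = A.card := by
  rw [card_insert_of_notMem (by simp [hi]), card_erase_add_one hj]

theorem card_shiftSet (F : Finset (Finset ℕ)) (i j : ℕ) (A : Finset ℕ) :
    (shiftSet F i j A).card = A.card := by
  unfold shiftSet
  split_ifs with h
  · exact card_insert_erase h.1 h.2.1
  · rfl

/-- Any m sets of the shifted family have a union no larger than that of some m sets of F. Usually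
the preimages serve; otherwise a member that stayed put because its shift was already in F is
exchanged for that shift. -/
theorem PropertyU.shift {m q : ℕ} {F : Finset (Finset ℕ)} (hU : PropertyU m q F) {i j : ℕ}
    (hij : i ≠ j) : PropertyU m q (F.image (shiftSet F i j)) := by
  intro G hG
  choose P hPF hPG using fun a => mem_image.1 (hG a)
  -- a member of the shifted family is either new, with preimage `P a`, or old
  by_cases hex : ∃ b, j ∈ G b ∧ i ∉ G b ∧ (∀ a, i ∈ G a → P a ≠ G a)
  · obtain ⟨b, hjb, hib, hnew⟩ := hex
    have hPb : P b = G b ∧ insert i ((G b).erase j) ∈ F := by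
      have h := hPG b
      unfold shiftSet at h
      split_ifs at h with h1
      · exact absurd (h ▸ mem_insert_self _ _) hib
      · refine ⟨h, ?_⟩
        by_contra h2
        exact h1 ⟨h ▸ hjb, h ▸ hib, h ▸ h2⟩
    -- If `i` is covered, the shift of `G b` covers it in F, and the preimage of a member that moved
    -- covers `j`.
    by_cases hi : ∃ a, i ∈ G a
    · obtain ⟨a₀, ha₀⟩ := hi
      refine le_trans (card_le_card ?_)
        (hU (fun a => if a = b then insert i ((G b).erase j) else P a) ?_)
      · intro x hx
        simp only [mem_biUnion, mem_univ, true_and] at hx ⊢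
        obtain ⟨a, ha⟩ := hx
        by_cases hxi : x = i
        · exact ⟨b, by simp [hxi]⟩
        by_cases hxj : x = j
        · refine ⟨a₀, ?_⟩
          have hne : a₀ ≠ b := by rintro rfl; exact hib ha₀
          rw [if_neg hne, hxj]
          have h := hPG a₀
          have hn := hnew a₀ ha₀
          unfold shiftSet at h
          split_ifs at h with h1
          · exact h1.1
          · exact absurd h hn
        · refine ⟨a, ?_⟩
          split_ifs with hab
          · subst hab
            simp [hxi, hxj, ha]
          · have h := hPG a
            unfold shiftSet at h
            split_ifs at h with h1
            · rw [← h] at ha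
              simpa [hxi, hxj] using ha
            · rwa [h]
      · intro a
        split_ifs
        · exact hPb.2
        · exact hPF a
    · have hGP : ∀ a, P a = G a := by
        intro a
        have h := hPG a
        unfold shiftSet at h
        split_ifs at h with h1
        · exact absurd ⟨a, h ▸ mem_insert_self _ _⟩ hi
        · exact h
      exact hU G fun a => hGP a ▸ hPF a
  · push Not at hex
    by_cases hnew : ∃ a, P a ≠ G a
    · by_cases hold : ∃ a, i ∈ G a ∧ P a = G a
      · refine le_trans (card_le_card ?_) (hU P hPF)
        intro x hx
        simp only [mem_biUnion, mem_univ, true_and] at hx ⊢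
        obtain ⟨a, ha⟩ := hx
        by_cases hxi : x = i
        · obtain ⟨c, hc, hPc⟩ := hold
          exact ⟨c, by rw [hPc, hxi]; exact hc⟩
        · refine ⟨a, ?_⟩
          have h := hPG a
          unfold shiftSet at h
          split_ifs at h with h1
          · rw [← h] at ha
            simp only [mem_insert, hxi, mem_erase, false_or] at ha
            exact ha.2
          · rwa [h]
      -- Every member containing `i` has moved, so by `hex` none contains `j`: the preimages lose at
      -- most `i` and gain `j`.
      · push Not at hold
        have hj : ∀ a, j ∉ G a := by
          intro a ha
          by_cases hia : i ∈ G a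
          · have h := hPG a
            have hn := hold a hia
            unfold shiftSet at h
            split_ifs at h with h1
            · rw [← h] at ha
              simp [hij.symm] at ha
            · exact hn h
          · obtain ⟨c, hc, hPc⟩ := hex a ha hia
            exact hold c hc hPc
        obtain ⟨a₀, ha₀⟩ := hnew
        have hja₀ : j ∈ P a₀ := by
          have h := hPG a₀
          unfold shiftSet at h
          split_ifs at h with h1
          · exact h1.1
          · exact absurd h ha₀
        refine le_trans ?_ (hU P hPF)
        have hsub : insert j ((univ.biUnion G).erase i) ⊆ univ.biUnion P := by
          intro x hx
          rw [mem_insert] at hx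
          rcases hx with rfl | hx
          · exact mem_biUnion.2 ⟨a₀, mem_univ _, hja₀⟩
          · simp only [mem_erase, mem_biUnion, mem_univ, true_and] at hx ⊢
            obtain ⟨hxi, a, ha⟩ := hx
            refine ⟨a, ?_⟩
            have h := hPG a
            unfold shiftSet at h
            split_ifs at h with h1
            · rw [← h] at ha
              simp only [mem_insert, hxi, mem_erase, false_or] at ha
              exact ha.2
            · rwa [h]
        refine le_trans ?_ (card_le_card hsub)
        rw [card_insert_of_notMem (by simp [hj])]
        have := pred_card_le_card_erase (s := univ.biUnion G) (a := i)
        omega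
    · push Not at hnew
      exact hU G fun a => hnew a ▸ hPF a

/-- Among the families with the same parameters there is a shifted one. -/
theorem exists_shifted {n k m q : ℕ} {F : Finset (Finset ℕ)}
    (hF : F ⊆ powersetCard k (Icc 1 n)) (hU : PropertyU m q F) :
    ∃ F' : Finset (Finset ℕ), F' ⊆ powersetCard k (Icc 1 n) ∧ PropertyU m q F' ∧
      F'.card = F.card ∧ Shifted F' := by
  induction h : ∑ A ∈ F, ∑ x ∈ A, x using Nat.strong_induction_on generalizing F with
  | _ N ih =>
    by_cases hS : Shifted F
    · exact ⟨F, hF, hU, rfl, hS⟩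
    · unfold Shifted at hS
      push Not at hS
      obtain ⟨A, hA, i, j, hi, hij, hjA, hiA, hnot⟩ := hS
      have hsum : ∀ B : Finset ℕ, j ∈ B → i ∉ B → ∑ x ∈ insert i (B.erase j), x < ∑ x ∈ B, x := by
        intro B hjB hiB
        rw [sum_insert (by simp [hiB]), ← add_sum_erase B (fun x => x) hjB]
        omega
      have hlt : ∑ B ∈ F.image (shiftSet F i j), ∑ x ∈ B, x < N := by
        rw [sum_image (shiftSet_injOn F i j), ← h]
        refine sum_lt_sum (fun B _ => ?_) ⟨A, hA, ?_⟩
        · unfold shiftSet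
          split_ifs with hB
          · exact (hsum B hB.1 hB.2.1).le
          · exact le_rfl
        · unfold shiftSet
          rw [if_pos ⟨hjA, hiA, hnot⟩]
          exact hsum A hjA hiA
      obtain ⟨F', h1, h2, h3, h4⟩ := ih _ hlt (F := F.image (shiftSet F i j)) (by
        intro B hB
        obtain ⟨C, hC, rfl⟩ := mem_image.1 hB
        have hC' := mem_powersetCard.1 (hF hC)
        refine mem_powersetCard.2 ⟨?_, by rw [card_shiftSet, hC'.2]⟩
        unfold shiftSet
        split_ifs with hcond
        · have := mem_Icc.1 (hC'.1 hcond.1)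
          exact insert_subset (mem_Icc.2 (by omega)) ((erase_subset _ _).trans hC'.1)
        · exact hC'.1) (hU.shift hij.ne) rfl
      exact ⟨F', h1, h2, h3.trans (card_image_of_injOn (shiftSet_injOn F i j)), h4⟩

/-- A shifted family contains every set that dominates one of its members. -/
theorem Shifted.mem_of_dominated {F : Finset (Finset ℕ)} (hF : Shifted F) {A B : Finset ℕ}
    (hA : A ∈ F) (hB : ∀ x ∈ B, 1 ≤ x) (hcard : A.card = B.card)
    (hdom : ∀ N, (A.filter (· ≤ N)).card ≤ (B.filter (· ≤ N)).card) : B ∈ F := by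
  induction h : (A \ B).card generalizing A with
  | zero =>
    rw [card_eq_zero, sdiff_eq_empty_iff_subset] at h
    rwa [← eq_of_subset_of_card_le h hcard.ge]
  | succ d ih =>
    have hne : (A \ B).Nonempty := card_pos.1 (by omega)
    have hne' : (B \ A).Nonempty := by
      rw [← card_pos, ← card_sdiff_comm hcard, h]; omega
    obtain ⟨y, hy, hymin⟩ := exists_min_image (A \ B) id hne
    obtain ⟨x, hx, hxmin⟩ := exists_min_image (B \ A) id hne'
    simp only [mem_sdiff, id] at hy hx hymin hxmin
    -- Otherwise `B` up to `y` would lie inside `A`, which also has `y`, against domination. Hence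
    -- `y` can be shifted to `x`.
    have hxy : x < y := by
      by_contra hcon
      have hlt : (B.filter (· ≤ y)) ⊂ (A.filter (· ≤ y)) := by
        refine (ssubset_iff_of_subset ?_).2 ⟨y, by simp [hy.1], by simp [hy.2]⟩
        intro z hz
        rw [mem_filter] at hz ⊢
        refine ⟨?_, hz.2⟩
        by_contra hzA
        have := hxmin z ⟨hz.1, hzA⟩
        have : z ≠ y := by rintro rfl; exact hy.2 hz.1
        omega
      exact absurd (hdom y) (not_le.2 (card_lt_card hlt))
    refine ih (hF A hA x y (hB x hx.1) hxy hy.1 hx.2)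
      ((card_insert_erase hy.1 hx.2).trans hcard) (fun N => ?_) ?_
    · by_cases hxN : x ≤ N
      · by_cases hyN : y ≤ N
        · rw [filter_insert, if_pos hxN, filter_erase, card_insert_erase (by simp [hy.1, hyN])
            (by simp [hx.2])]
          exact hdom N
        · rw [filter_insert, if_pos hxN, filter_erase, erase_eq_of_notMem (by simp [hyN])]
          refine card_le_card (insert_subset (by simp [hx.1, hxN]) fun z hz => ?_)
          rw [mem_filter] at hz ⊢
          refine ⟨?_, hz.2⟩
          by_contra hzB
          have := hymin z ⟨hz.1, hzB⟩
          omega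
      · rw [filter_insert, if_neg hxN, filter_erase]
        exact (card_le_card (erase_subset _ _)).trans (hdom N)
    · have : insert x (A.erase y) \ B = (A \ B).erase y := by
        ext z
        simp only [mem_sdiff, mem_insert, mem_erase]
        constructor
        · rintro ⟨rfl | h1, h2⟩
          · exact absurd hx.1 h2
          · exact ⟨h1.1, h1.2, h2⟩
        · rintro ⟨h1, h2, h3⟩
          exact ⟨Or.inr ⟨h1, h2⟩, h3⟩
      rw [this, card_erase_of_mem (by simp [hy.1, hy.2]), h]
      rfl

/-! ### A local bound on the shadow -/

/-- If every member of a family has, for some `i ≥ 1`, at least `i` elements among the first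
`i (s + 1) - 1` integers above `a`, then the family is at most `s` times as large as its shadow. -/
theorem card_le_mul_card_shadow {s a : ℕ} {H : Finset (Finset ℕ)}
    (hH : ∀ A ∈ H, ∃ i, 1 ≤ i ∧ i ≤ (A ∩ Ioo a (a + i * (s + 1))).card) :
    H.card ≤ s * H.shadow.card := by
  classical
  -- The largest admissible `i` is chosen: the window then holds exactly `i` elements, and all
  -- larger windows are underfull.
  have hmax : ∀ A ∈ H, ∃ i, 1 ≤ i ∧ (A ∩ Ioo a (a + i * (s + 1))).card = i ∧
      ∀ i', i < i' → (A ∩ Ioo a (a + i' * (s + 1))).card < i' := by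
    intro A hA
    obtain ⟨i₀, h1, h2⟩ := hH A hA
    let P := fun i => i ≤ (A ∩ Ioo a (a + i * (s + 1))).card
    have hb : ∀ i, P i → i ≤ A.card := fun i hi => hi.trans (card_le_card inter_subset_left)
    have hP : P (Nat.findGreatest P A.card) := Nat.findGreatest_spec (hb i₀ h2) h2
    have hge : i₀ ≤ Nat.findGreatest P A.card := Nat.le_findGreatest (hb i₀ h2) h2
    have hgt : ∀ i', Nat.findGreatest P A.card < i' →
        (A ∩ Ioo a (a + i' * (s + 1))).card < i' := by
      intro i' hi'
      by_contra hcon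
      have hPi : P i' := not_lt.1 hcon
      exact absurd (Nat.le_findGreatest (hb i' hPi) hPi) (not_le.2 hi')
    refine ⟨_, h1.trans hge, le_antisymm ?_ hP, hgt⟩
    have h3 := hgt _ (Nat.lt_succ_self _)
    refine le_trans (card_le_card (inter_subset_inter_left (Ioo_subset_Ioo_right ?_)))
      (Nat.lt_succ_iff.1 h3)
    gcongr
    exact Nat.le_succ _
  choose! ι hι1 hι2 hι3 using hmax
  let S : ℕ → Finset (Finset ℕ) := fun i =>
    ((H.filter fun A => ι A = i).biUnion fun A =>
      (A ∩ Ioo a (a + i * (s + 1))).image fun x => A.erase x)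
  have hmem : ∀ i B, B ∈ S i ↔ ∃ A ∈ H, ι A = i ∧ ∃ x ∈ A, x ∈ Ioo a (a + i * (s + 1)) ∧
      A.erase x = B := by
    intro i B
    simp only [S, mem_biUnion, mem_filter, mem_image, mem_inter, and_assoc]
  have hcls : ∀ i, (H.filter fun A => ι A = i).card ≤ s * (S i).card := by
    intro i
    rcases Nat.eq_zero_or_pos i with rfl | hi
    · rw [filter_eq_empty_iff.2 fun A hA h0 => absurd (hι1 A hA) (by omega)]
      simp
    refine Nat.le_of_mul_le_mul_right (c := i) ?_ hi
    -- Double counting: `A` can lose any of `i` window elements, while `B` retains `i - 1` of the `i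
    -- * (s + 1) - 1` window points, leaving `i * s` candidates to restore.
    have key : (H.filter fun A => ι A = i).card * i ≤ (S i).card * (i * s) := by
      refine card_mul_le_card_mul
        (fun A B => ∃ x ∈ A, x ∈ Ioo a (a + i * (s + 1)) ∧ A.erase x = B) ?_ ?_
      · intro A hA
        obtain ⟨hA, hAi⟩ := mem_filter.1 hA
        have hinj : Set.InjOn (fun x => A.erase x) (A ∩ Ioo a (a + i * (s + 1)) : Finset ℕ) := by
          intro x hx y hy hxy
          rw [mem_coe, mem_inter] at hx hy
          exact erase_injOn A hx.1 hy.1 hxy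
        have h4 := hι2 A hA
        rw [hAi] at h4
        have h5 := card_image_of_injOn hinj
        rw [h4] at h5
        refine h5.ge.trans (card_le_card fun B hB => ?_)
        obtain ⟨x, hx, rfl⟩ := mem_image.1 hB
        rw [mem_inter] at hx
        rw [mem_bipartiteAbove]
        exact ⟨(hmem _ _).2 ⟨A, hA, hAi, x, hx.1, hx.2, rfl⟩, x, hx.1, hx.2, rfl⟩
      · intro B hB
        obtain ⟨A, hA, hAi, x, hxA, hx, rfl⟩ := (hmem _ _).1 hB
        have h4 := hι2 A hA
        rw [hAi] at h4
        have hsub : (bipartiteBelow (fun A B => ∃ x ∈ A, x ∈ Ioo a (a + i * (s + 1)) ∧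
            A.erase x = B) (H.filter fun A => ι A = i) (A.erase x)) ⊆
            (Ioo a (a + i * (s + 1)) \ A.erase x).image fun y => insert y (A.erase x) := by
          intro C hC
          obtain ⟨-, y, hyC, hy, hyx⟩ := (mem_bipartiteBelow _).1 hC
          refine mem_image.2 ⟨y, mem_sdiff.2 ⟨hy, ?_⟩, ?_⟩
          · rw [← hyx]; exact notMem_erase _ _
          · rw [← hyx]; exact insert_erase hyC
        refine (card_le_card hsub).trans (card_image_le.trans ?_)
        rw [card_sdiff, erase_inter, card_erase_of_mem (mem_inter.2 ⟨hxA, hx⟩), h4, Nat.card_Ioo]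
        have : i * (s + 1) = i * s + i := by ring
        omega
    linarith
  -- For `i < i'`, a set in `S i` has fewer than `i' - 1` elements in the window of `i'`, a set in
  -- `S i'` exactly `i' - 1`.
  have hdisj : (range (H.sup card + 1) : Set ℕ).PairwiseDisjoint S := by
    have main : ∀ i i', i < i' → ∀ B, B ∈ S i → B ∉ S i' := by
      intro i i' hii B hB hB'
      obtain ⟨A, hA, hAi, x, hxA, hx, rfl⟩ := (hmem _ _).1 hB
      obtain ⟨A', hA', hAi', x', hxA', hx', he⟩ := (hmem _ _).1 hB'
      have h5 := hι3 A hA i' (by omega)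
      have h6 := hι2 A' hA'
      rw [hAi'] at h6
      have hx2 : x ∈ Ioo a (a + i' * (s + 1)) :=
        Ioo_subset_Ioo_right (by gcongr) hx
      have h7 : ((A.erase x) ∩ Ioo a (a + i' * (s + 1))).card =
          ((A'.erase x') ∩ Ioo a (a + i' * (s + 1))).card := by rw [he]
      rw [erase_inter, erase_inter, card_erase_of_mem (mem_inter.2 ⟨hxA, hx2⟩),
        card_erase_of_mem (mem_inter.2 ⟨hxA', hx'⟩), h6] at h7
      have := card_pos.2 ⟨x, mem_inter.2 ⟨hxA, hx2⟩⟩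
      omega
    intro i _ i' _ hne
    rw [Function.onFun, disjoint_left]
    rcases lt_or_gt_of_ne hne with h | h
    · exact fun B => main i i' h B
    · exact fun B hB hB' => main i' i h B hB' hB
  calc H.card = ∑ i ∈ range (H.sup card + 1), (H.filter fun A => ι A = i).card := by
        refine card_eq_sum_card_fiberwise fun A hA => ?_
        rw [mem_coe] at hA
        rw [mem_coe, mem_range, Nat.lt_succ_iff, ← hι2 A hA]
        exact (card_le_card inter_subset_left).trans (le_sup (f := card) hA)
    _ ≤ ∑ i ∈ range (H.sup card + 1), s * (S i).card := sum_le_sum fun i _ => hcls i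
    _ = s * ((range (H.sup card + 1)).biUnion S).card := by
        rw [← mul_sum, card_biUnion hdisj]
    _ ≤ s * H.shadow.card := by
        refine Nat.mul_le_mul_left _ (card_le_card fun B hB => ?_)
        obtain ⟨i, -, hB⟩ := mem_biUnion.1 hB
        obtain ⟨A, hA, -, x, hx, -, rfl⟩ := (hmem _ _).1 hB
        exact mem_shadow_iff.2 ⟨A, hA, x, hx, rfl⟩

/-! ### Chains without distinct representatives -/

/-- A chain `D 0 ⊆ ⋯ ⊆ D j` of finite sets in which no system of distinct representatives exists
has a member `D i` of size at most `i`. -/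
theorem exists_card_le_of_no_sdr {α : Type*} [DecidableEq α] {D : ℕ → Finset α} {j : ℕ}
    (hno : ¬ ∃ b : ℕ → α, (∀ i ≤ j, b i ∈ D i) ∧ ∀ i ≤ j, ∀ i' < i, b i' ≠ b i) :
    ∃ i ≤ j, (D i).card ≤ i := by
  by_contra! hcon
  apply hno
  clear hno
  induction j with
  | zero =>
    obtain ⟨x, hx⟩ := card_pos.1 (hcon 0 le_rfl)
    exact ⟨fun _ => x, fun i hi => by rwa [Nat.le_zero.1 hi], fun i hi i' hi' => by omega⟩
  | succ j ih =>
    obtain ⟨b, hb, hb'⟩ := ih fun i hi => hcon i (by omega)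
    obtain ⟨x, hx, hxb⟩ := exists_mem_notMem_of_card_lt_card
      (lt_of_le_of_lt (card_image_le (s := range (j + 1)) (f := b)) (by
        rw [card_range]; exact hcon (j + 1) le_rfl))
    refine ⟨Function.update b (j + 1) x, fun i hi => ?_, fun i hi i' hi' => ?_⟩
    · rcases Nat.lt_or_ge j i with h | h
      · obtain rfl : i = j + 1 := by omega
        simpa using hx
      · rw [Function.update_of_ne (by omega)]
        exact hb i h
    · rw [Function.update_of_ne (by omega : i' ≠ j + 1)]
      rcases Nat.lt_or_ge j i with h | h
      · obtain rfl : i = j + 1 := by omega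
        rw [Function.update_self]
        rintro rfl
        exact hxb (mem_image.2 ⟨i', mem_range.2 hi', rfl⟩)
      · rw [Function.update_of_ne (by omega)]
        exact hb' i h i' hi'

/-- If |D i| ≤ i, the sum is at most i² + (j-i)t and |D 0| ≤ i, so the left side is at most jt -
i(j-i). -/
theorem sum_card_le_of_no_sdr {α : Type*} [DecidableEq α] {D : ℕ → Finset α} {j t : ℕ}
    (hmono : ∀ i ≤ j, ∀ i' ≤ i, D i' ⊆ D i) (ht : ∀ i ≤ j, (D i).card ≤ t) (hjt : j ≤ t)
    (hno : ¬ ∃ b : ℕ → α, (∀ i ≤ j, b i ∈ D i) ∧ ∀ i ≤ j, ∀ i' < i, b i' ≠ b i) :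
    ∑ i ∈ Icc 1 j, (D i).card + (t - j) * (D 0).card ≤ j * t := by
  obtain ⟨i, hij, hi⟩ := exists_card_le_of_no_sdr hno
  have h0 : (D 0).card ≤ i := (card_le_card (hmono i hij 0 (Nat.zero_le _))).trans hi
  have h1 : ∑ a ∈ Icc 1 j, (D a).card ≤ i * i + (j - i) * t := by
    have hsplit : Icc 1 j = Icc 1 i ∪ Ioc i j := by
      ext x; simp only [mem_Icc, mem_union, mem_Ioc]; omega
    rw [hsplit, sum_union (disjoint_left.2 fun x hx hx' => by
      rw [mem_Icc] at hx; rw [mem_Ioc] at hx'; omega)]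
    refine add_le_add ((sum_le_card_nsmul _ _ i fun a ha => ?_).trans (by simp))
      ((sum_le_card_nsmul _ _ t fun a ha => ?_).trans (by simp))
    · rw [mem_Icc] at ha
      exact (card_le_card (hmono i hij a ha.2)).trans hi
    · exact ht a (mem_Ioc.1 ha).2
  obtain ⟨c, rfl⟩ := Nat.exists_eq_add_of_le hij
  obtain ⟨e, rfl⟩ := Nat.exists_eq_add_of_le hjt
  simp only [Nat.add_sub_cancel_left] at h1 ⊢
  nlinarith [Nat.mul_le_mul_left e h0]

/-! ### The weighted inequality for arcs on a circle -/

/-- The arc of length `l` starting at `x` on the circle `{0, …, m - 1}`. -/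
def arc (m l x : ℕ) : Finset ℕ := (range l).image fun k => (x + k) % m

theorem disjoint_arc {m l x y : ℕ} (h1 : x + l ≤ y) (h2 : y + l ≤ x + m) :
    Disjoint (arc m l x) (arc m l y) := by
  rw [disjoint_left]
  intro z hz hz'
  obtain ⟨a, ha, rfl⟩ := mem_image.1 hz
  obtain ⟨b, hb, he⟩ := mem_image.1 hz'
  rw [mem_range] at ha hb
  have hd := (Nat.modEq_iff_dvd' (by omega : x + a ≤ y + b)).1 (Eq.symm he)
  exact absurd (Nat.le_of_dvd (by omega) hd) (by omega)

/-- At most `2 * l` arcs of length `l` meet a given one. -/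
theorem card_filter_not_disjoint_arc {m l x : ℕ} (hl : l ≤ m) {A : Finset ℕ} (hA : A ⊆ range m) :
    (A.filter fun y => ¬ Disjoint (arc m l x) (arc m l y)).card ≤ 2 * l := by
  have hsub : (A.filter fun y => ¬ Disjoint (arc m l x) (arc m l y)) ⊆
      (range (2 * l)).image fun d => (x + m - l + d) % m := by
    intro y hy
    obtain ⟨hyA, hy⟩ := mem_filter.1 hy
    obtain ⟨z, hz, hz'⟩ := not_disjoint_iff.1 hy
    obtain ⟨a, ha, rfl⟩ := mem_image.1 hz
    obtain ⟨b, hb, he⟩ := mem_image.1 hz'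
    have hym := mem_range.1 (hA hyA)
    rw [mem_range] at ha hb
    refine mem_image.2 ⟨l + a - b, mem_range.2 (by omega), ?_⟩
    have h : x + m - l + (l + a - b) + b ≡ y + b [MOD m] := by
      have : x + m - l + (l + a - b) + b = x + a + m := by omega
      rw [this]
      exact (Nat.add_mod_right _ _).trans he.symm
    have h' := Nat.ModEq.add_right_cancel' b h
    rw [h', Nat.mod_eq_of_lt hym]
  exact (card_le_card hsub).trans (card_image_le.trans (by rw [card_range]))

/-- A chain of sets of arcs without a system of disjoint representatives is small, provided that
its largest member is small enough to be squeezed into a circle of length `2 * j * l`. -/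
theorem sum_card_arcs_le_of_card_le {m l j : ℕ} {A : ℕ → Finset ℕ} (hl : 0 < l)
    (hA : A j ⊆ range m) (hmono : ∀ i ≤ j, ∀ i' ≤ i, A i' ⊆ A i) (hm : l * (2 * j) ≤ m)
    (hcard : (A j).card ≤ l * (2 * j))
    (hno : ¬ ∃ b : ℕ → ℕ, (∀ i ≤ j, b i ∈ A i) ∧
      ∀ i ≤ j, ∀ i' < i, Disjoint (arc m l (b i')) (arc m l (b i))) :
    ∑ i ∈ Icc 1 j, (A i).card + j * (A 0).card ≤ l * (j * (2 * j)) := by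
  -- `A j` is padded to exactly 2jl points, which are renumbered by rank as a circle of length 2jl.
  -- Both ways round, true distances are at least rank distances, so starting points with ranks
  -- congruent mod `l` carry disjoint arcs. Each residue class has 2j ranks, and the chain bound
  -- applies to it with t = 2j.
  obtain ⟨S, hAS, hSm, hS⟩ := exists_subsuperset_card_eq hA hcard (by rwa [card_range])
  let rk : ℕ → ℕ := fun x => (S.filter (· < x)).card
  have hrk : ∀ x ∈ S, rk x < l * (2 * j) := by
    intro x hx
    rw [← hS]
    exact card_lt_card ((ssubset_iff_of_subset (filter_subset _ _)).2 ⟨x, hx, by simp⟩)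
  have hsplit : ∀ x y, x ≤ y → rk y = rk x + (S.filter fun z => x ≤ z ∧ z < y).card := by
    intro x y hxy
    simp only [rk]
    rw [← card_union_of_disjoint (disjoint_left.2 fun z hz hz' => by
      simp only [mem_filter] at hz hz'; omega)]
    congr 1
    ext z
    simp only [mem_filter, mem_union]
    constructor
    · rintro ⟨h1, h2⟩
      rcases lt_or_ge z x with h | h
      · exact Or.inl ⟨h1, h⟩
      · exact Or.inr ⟨h1, h, h2⟩
    · rintro (⟨h1, h2⟩ | ⟨h1, h2, h3⟩)
      · exact ⟨h1, by omega⟩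
      · exact ⟨h1, h3⟩
  have hlt : ∀ x ∈ S, ∀ y, x < y → rk x < rk y := by
    intro x hx y hxy
    rw [hsplit x y hxy.le]
    have : 0 < (S.filter fun z => x ≤ z ∧ z < y).card :=
      card_pos.2 ⟨x, mem_filter.2 ⟨hx, le_rfl, hxy⟩⟩
    omega
  have hinj : ∀ x ∈ S, ∀ y ∈ S, rk x = rk y → x = y := by
    intro x hx y hy h
    rcases lt_trichotomy x y with hxy | hxy | hxy
    · exact absurd (hlt x hx y hxy) (by omega)
    · exact hxy
    · exact absurd (hlt y hy x hxy) (by omega)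
  have hgap : ∀ x ∈ S, ∀ y ∈ S, x < y → rk x % l = rk y % l →
      Disjoint (arc m l x) (arc m l y) := by
    intro x hx y hy hxy hmod
    have h1 := hsplit x y hxy.le
    have h2 := hlt x hx y hxy
    obtain ⟨c, hc⟩ := (Nat.modEq_iff_dvd' h2.le).1 hmod
    have h3 := hrk y hy
    have hc0 : 1 ≤ c := Nat.pos_of_ne_zero fun h0 => by rw [h0] at hc; omega
    have hc1 : c + 1 ≤ 2 * j := by
      have : l * c < l * (2 * j) := by omega
      exact Nat.lt_of_mul_lt_mul_left this
    have h4 : l * 1 ≤ l * c := Nat.mul_le_mul_left l hc0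
    have h5 : l * (c + 1) ≤ l * (2 * j) := Nat.mul_le_mul_left l hc1
    rw [Nat.mul_succ] at h5
    have h6 : (S.filter fun z => x ≤ z ∧ z < y).card ≤ y - x := by
      rw [← Nat.card_Ico]
      exact card_le_card fun z hz => by
        simp only [mem_filter] at hz; rw [mem_Ico]; exact hz.2
    have h7 : (S.filter fun z => ¬ (x ≤ z ∧ z < y)).card ≤ m - (y - x) := by
      have hy' := mem_range.1 (hSm hy)
      have : (range m \ Ico x y).card = m - (y - x) := by
        rw [card_sdiff_of_subset fun z hz => by rw [mem_Ico] at hz; rw [mem_range]; omega,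
          card_range, Nat.card_Ico]
      rw [← this]
      exact card_le_card fun z hz => by
        simp only [mem_filter] at hz
        rw [mem_sdiff, mem_Ico]
        exact ⟨hSm hz.1, hz.2⟩
    have h8 := card_filter_add_card_filter_not (s := S) (fun z => x ≤ z ∧ z < y)
    have hy' := mem_range.1 (hSm hy)
    exact disjoint_arc (by omega) (by omega)
  have hAi : ∀ i ≤ j, A i ⊆ S := fun i hi => (hmono j le_rfl i hi).trans hAS
  let D : ℕ → ℕ → Finset ℕ := fun c i => (A i).filter fun x => rk x % l = c
  have hsum : ∀ i, (A i).card = ∑ c ∈ range l, (D c i).card := fun i =>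
    card_eq_sum_card_fiberwise fun x _ => mem_range.2 (Nat.mod_lt _ hl)
  have hclass : ∀ c ∈ range l,
      ∑ i ∈ Icc 1 j, (D c i).card + (2 * j - j) * (D c 0).card ≤ j * (2 * j) := by
    intro c _
    refine sum_card_le_of_no_sdr (fun i hi i' hi' => filter_subset_filter _ (hmono i hi i' hi'))
      (fun i hi => ?_) (by omega) ?_
    · rw [← card_range (2 * j)]
      refine card_le_card_of_injOn (fun x => rk x / l) (fun x hx => ?_) ?_
      · rw [mem_coe] at hx ⊢
        exact mem_range.2 (Nat.div_lt_of_lt_mul (hrk x (hAi i hi (mem_filter.1 hx).1)))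
      · intro x hx y hy h
        rw [mem_coe, mem_filter] at hx hy
        refine hinj x (hAi i hi hx.1) y (hAi i hi hy.1) ?_
        have h' : rk x / l = rk y / l := h
        rw [← Nat.div_add_mod (rk x) l, ← Nat.div_add_mod (rk y) l, h', hx.2, hy.2]
    · rintro ⟨b, hb, hb'⟩
      refine hno ⟨b, fun i hi => (mem_filter.1 (hb i hi)).1, fun i hi i' hi' => ?_⟩
      have h1 := mem_filter.1 (hb i hi)
      have h2 := mem_filter.1 (hb i' (by omega))
      rcases lt_or_gt_of_ne (hb' i hi i' hi') with h | h
      · exact hgap _ (hAi i' (by omega) h2.1) _ (hAi i hi h1.1) h (h2.2.trans h1.2.symm)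
      · exact (hgap _ (hAi i hi h1.1) _ (hAi i' (by omega) h2.1) h
          (h1.2.trans h2.2.symm)).symm
  have htot := sum_le_sum hclass
  rw [sum_add_distrib, sum_comm, ← mul_sum, sum_const, card_range, smul_eq_mul, ← hsum 0,
    sum_congr rfl fun i _ => (hsum i).symm, show 2 * j - j = j by omega] at htot
  exact htot

/-- The circle version of the weighted inequality for chains of cross-dependent families. -/
theorem sum_card_arcs_le {m l s : ℕ} {A : ℕ → Finset ℕ} (hl : 0 < l)
    (hA : ∀ i ≤ s, A i ⊆ range m) (hmono : ∀ i ≤ s, ∀ i' ≤ i, A i' ⊆ A i)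
    (hm : 2 * s * l ≤ m)
    (hno : ¬ ∃ b : ℕ → ℕ, (∀ i ≤ s, b i ∈ A i) ∧
      ∀ i ≤ s, ∀ i' < i, Disjoint (arc m l (b i')) (arc m l (b i))) :
    l * ∑ i ∈ Icc 1 s, (A i).card + (m - s * l) * (A 0).card ≤ s * m * l := by
  classical
  let P : ℕ → Prop := fun j => ¬ ∃ b : ℕ → ℕ, (∀ i ≤ j, b i ∈ A i) ∧
      ∀ i ≤ j, ∀ i' < i, Disjoint (arc m l (b i')) (arc m l (b i))
  have hex : ∃ j, P j := ⟨s, hno⟩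
  -- At the least failing `j`, every arc in `A j` meets one of `j` disjoint arcs representing the
  -- earlier families; hence |A j| ≤ 2jl.
  obtain ⟨j, hPj, hmin⟩ : ∃ j, P j ∧ ∀ i < j, ¬ P i :=
    ⟨Nat.find hex, Nat.find_spec hex, fun i => Nat.find_min hex⟩
  have hjs : j ≤ s := by
    by_contra hcon
    exact hmin s (by omega) hno
  have hle : ∀ i, (hi : i ≤ s) → (A i).card ≤ m := fun i hi => by
    simpa using card_le_card (hA i hi)
  rcases Nat.eq_zero_or_pos j with h0 | hpos
  · have hempty : A 0 = ∅ := by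
      by_contra hne
      obtain ⟨x, hx⟩ := nonempty_iff_ne_empty.2 hne
      rw [h0] at hPj
      exact hPj ⟨fun _ => x, fun i hi => by rwa [Nat.le_zero.1 hi], fun i hi i' hi' => by omega⟩
    rw [hempty, card_empty, mul_zero, add_zero]
    have := sum_le_card_nsmul (Icc 1 s) (fun i => (A i).card) m fun i hi =>
      hle i (mem_Icc.1 hi).2
    rw [Nat.card_Icc, smul_eq_mul, Nat.add_sub_cancel] at this
    rw [mul_comm]
    exact Nat.mul_le_mul_right l this
  · have hnP : ¬ P (j - 1) := hmin (j - 1) (by omega)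
    obtain ⟨b, hb, hb'⟩ := not_not.1 hnP
    have hjl : l * (2 * j) ≤ m := le_trans (by nlinarith) hm
    have hlm : l ≤ m := le_trans (by nlinarith) hjl
    have hcard : (A j).card ≤ l * (2 * j) := by
      have hcov : A j ⊆ (range j).biUnion fun i =>
          (A j).filter fun y => ¬ Disjoint (arc m l (b i)) (arc m l y) := by
        intro y hy
        by_contra hcon
        simp only [mem_biUnion, mem_range, mem_filter, not_exists, not_and, not_not] at hcon
        refine hPj ⟨Function.update b j y, fun i hi => ?_, fun i hi i' hi' => ?_⟩
        · rcases eq_or_ne i j with h | h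
          · rw [h, Function.update_self]; exact hy
          · rw [Function.update_of_ne h]
            exact hb i (by omega)
        · rw [Function.update_of_ne (by omega : i' ≠ j)]
          rcases eq_or_ne i j with h | h
          · rw [h, Function.update_self]
            exact hcon i' (by omega) hy
          · rw [Function.update_of_ne h]
            exact hb' i (by omega) i' hi'
      refine (card_le_card hcov).trans (card_biUnion_le.trans ?_)
      refine (sum_le_card_nsmul _ _ (2 * l) fun i _ =>
        card_filter_not_disjoint_arc hlm (hA j hjs)).trans ?_
      rw [card_range, smul_eq_mul]
      exact le_of_eq (by ring)
    have key := sum_card_arcs_le_of_card_le hl (hA j hjs)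
      (fun i hi => hmono i (hi.trans hjs)) hjl hcard hPj
    -- After scaling by `l`, `key` absorbs only the part jl of the weight m - sl on |A 0|; the
    -- remainder, nonnegative because m ≥ 2sl, is handled by this bound.
    have hA0 : (A 0).card ≤ l * j := by
      have h1 : j * (A 0).card ≤ ∑ i ∈ Icc 1 j, (A i).card := by
        have := card_nsmul_le_sum (Icc 1 j) (fun i => (A i).card) (A 0).card fun i hi =>
          card_le_card (hmono i ((mem_Icc.1 hi).2.trans hjs) 0 (Nat.zero_le _))
        rwa [Nat.card_Icc, smul_eq_mul, Nat.add_sub_cancel] at this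
      have h2 : (2 * j) * (A 0).card ≤ (2 * j) * (l * j) := by nlinarith
      exact Nat.le_of_mul_le_mul_left h2 (by omega)
    have htail : ∑ i ∈ Ioc j s, (A i).card ≤ (s - j) * m := by
      have := sum_le_card_nsmul (Ioc j s) (fun i => (A i).card) m fun i hi =>
        hle i (mem_Ioc.1 hi).2
      rwa [Nat.card_Ioc, smul_eq_mul] at this
    have hsplit : Icc 1 s = Icc 1 j ∪ Ioc j s := by
      ext x; simp only [mem_Icc, mem_union, mem_Ioc]; omega
    rw [hsplit, sum_union (disjoint_left.2 fun x hx hx' => by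
      rw [mem_Icc] at hx; rw [mem_Ioc] at hx'; omega)]
    obtain ⟨c, rfl⟩ := Nat.exists_eq_add_of_le hjs
    obtain ⟨e, rfl⟩ := Nat.exists_eq_add_of_le hm
    rw [Nat.add_sub_cancel_left] at htail
    have hsub : 2 * (j + c) * l + e - (j + c) * l = (j + c) * l + e := by
      have : 2 * (j + c) * l = (j + c) * l + (j + c) * l := by ring
      omega
    rw [hsub]
    have e1 : l * (∑ i ∈ Icc 1 j, (A i).card + j * (A 0).card) ≤ l * (l * (j * (2 * j))) := Nat.mul_le_mul_left l key
    have e2 : l * ∑ i ∈ Ioc j (j + c), (A i).card ≤ l * (c * (2 * (j + c) * l + e)) := Nat.mul_le_mul_left l htail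
    have e3 : (c * l + e) * (A 0).card ≤ (c * l + e) * (l * j) := Nat.mul_le_mul_left _ hA0
    have e4 : 0 ≤ l * l * j * c := Nat.zero_le _
    nlinarith only [e1, e2, e3, e4]

/-! ### Averaging over permutations -/

section Averaging

variable {α : Type*} [Fintype α] [DecidableEq α]

theorem exists_perm_image_eq {A B : Finset α} (h : A.card = B.card) :
    ∃ τ : Equiv.Perm α, A.image τ = B := by
  let e : {x // x ∈ A} ≃ {x // x ∈ B} := Finset.equivOfCardEq h
  refine ⟨e.extendSubtype, eq_of_subset_of_card_le (fun y hy => ?_) ?_⟩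
  · obtain ⟨x, hx, rfl⟩ := mem_image.1 hy
    exact e.extendSubtype_mem x hx
  · rw [card_image_of_injective _ (Equiv.injective _), h]

/-- The number of permutations mapping a given `l`-set to a member of a family of `l`-sets is
proportional to the size of the family. -/
theorem choose_mul_card_perm_image_mem {l : ℕ} {A : Finset α} (hA : A.card = l)
    {G : Finset (Finset α)} (hG : G ⊆ powersetCard l univ) :
    (Fintype.card α).choose l *
      (univ.filter fun σ : Equiv.Perm α => A.image σ ∈ G).card =
      G.card * (Fintype.card α).factorial := by
  set K := (univ.filter fun σ : Equiv.Perm α => A.image σ = A).card with hK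
  have hconst : ∀ B : Finset α, B.card = l →
      (univ.filter fun σ : Equiv.Perm α => A.image σ = B).card = K := by
    intro B hB
    obtain ⟨τ, rfl⟩ := exists_perm_image_eq (hA.trans hB.symm)
    refine (card_bij (fun σ _ => τ * σ) (fun σ hσ => ?_) (fun _ _ _ _ h => mul_left_cancel h)
      fun σ hσ => ⟨τ⁻¹ * σ, ?_, mul_inv_cancel_left _ _⟩).symm
    · simp only [mem_filter, mem_univ, true_and] at hσ ⊢
      rw [Equiv.Perm.coe_mul, ← image_image, hσ]
    · simp only [mem_filter, mem_univ, true_and] at hσ ⊢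
      rw [Equiv.Perm.coe_mul, ← image_image, hσ, image_image, ← Equiv.Perm.coe_mul,
        inv_mul_cancel]
      simp
  have hcount : ∀ G' : Finset (Finset α), G' ⊆ powersetCard l univ →
      (univ.filter fun σ : Equiv.Perm α => A.image σ ∈ G').card = G'.card * K := by
    intro G' hG'
    have hfib := card_eq_sum_card_fiberwise
      (s := univ.filter fun σ : Equiv.Perm α => A.image σ ∈ G')
      (f := fun σ : Equiv.Perm α => A.image σ) (t := G') fun σ hσ => (mem_filter.1 hσ).2
    rw [hfib, ← smul_eq_mul, ← sum_const]
    refine sum_congr rfl fun B hB => ?_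
    rw [← hconst B (mem_powersetCard.1 (hG' hB)).2, filter_filter]
    congr 1
    ext σ
    simp only [mem_filter, mem_univ, true_and]
    exact ⟨fun h => h.2, fun h => ⟨h ▸ hB, h⟩⟩
  -- The family of all `l`-sets counts every permutation, which evaluates `K`.
  have hall := hcount (powersetCard l univ) Subset.rfl
  rw [filter_true_of_mem fun σ _ => mem_powersetCard.2 ⟨subset_univ _, by
    rw [card_image_of_injective _ (Equiv.injective _), hA]⟩, card_powersetCard, card_univ,
    card_univ, Fintype.card_perm] at hall
  rw [hcount G hG, hall]
  ring

/-- The weighted inequality for chains of cross-dependent families of `l`-sets. -/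
theorem sum_card_le_of_cross_dependent {l s : ℕ} {G : ℕ → Finset (Finset α)} (hl : 0 < l)
    (hs : 1 ≤ s) (hG : ∀ i ≤ s, G i ⊆ powersetCard l univ)
    (hmono : ∀ i ≤ s, ∀ i' ≤ i, G i' ⊆ G i) (hm : 2 * s * l ≤ Fintype.card α)
    (hno : ¬ ∃ B : ℕ → Finset α, (∀ i ≤ s, B i ∈ G i) ∧
      ∀ i ≤ s, ∀ i' < i, Disjoint (B i') (B i)) :
    l * ∑ i ∈ Icc 1 s, (G i).card + (Fintype.card α - s * l) * (G 0).card ≤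
      s * l * (Fintype.card α).choose l := by
  obtain ⟨m, hmα⟩ : ∃ m, Fintype.card α = m := ⟨_, rfl⟩
  rw [hmα] at hm ⊢
  have hlm : l ≤ m := le_trans (by nlinarith) hm
  have hm0 : 0 < m := by omega
  let e : Fin m ≃ α := (Fintype.equivFinOfCardEq hmα).symm
  let e' : ℕ → α := fun a => e ⟨a % m, Nat.mod_lt _ hm0⟩
  have he' : ∀ a < m, ∀ b < m, e' a = e' b → a = b := by
    intro a ha b hb hab
    have := Fin.mk.inj_iff.1 (e.injective hab)
    rwa [Nat.mod_eq_of_lt ha, Nat.mod_eq_of_lt hb] at this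
  have harc : ∀ x, ∀ a ∈ arc m l x, a < m := by
    intro x a ha
    obtain ⟨k, -, rfl⟩ := mem_image.1 ha
    exact Nat.mod_lt _ hm0
  let base : ℕ → Finset α := fun x => (arc m l x).image e'
  have hbase : ∀ x, (base x).card = l := by
    intro x
    rw [card_image_of_injOn fun a ha b hb => he' a (harc x a ha) b (harc x b hb), arc,
      card_image_of_injOn, card_range]
    intro a ha b hb hab
    have ha' := mem_range.1 ha
    have hb' := mem_range.1 hb
    have h : a ≡ b [MOD m] := Nat.ModEq.add_left_cancel' x hab
    exact h.eq_of_lt_of_lt (by omega) (by omega)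
  have hdisj : ∀ x y, Disjoint (arc m l x) (arc m l y) → Disjoint (base x) (base y) := by
    intro x y h
    rw [disjoint_left] at h ⊢
    intro z hz hz'
    obtain ⟨a, ha, rfl⟩ := mem_image.1 hz
    obtain ⟨b, hb, hab⟩ := mem_image.1 hz'
    exact h ha (he' b (harc y b hb) a (harc x a ha) hab ▸ hb)
  -- Katona's method: the circle inequality holds for the arcs sent into `G i` by each σ, and each
  -- arc is sent there equally often.
  let A : Equiv.Perm α → ℕ → Finset ℕ := fun σ i =>
    (range m).filter fun x => (base x).image σ ∈ G i
  have hcirc : ∀ σ : Equiv.Perm α,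
      l * ∑ i ∈ Icc 1 s, (A σ i).card + (m - s * l) * (A σ 0).card ≤ s * m * l := by
    intro σ
    refine sum_card_arcs_le hl (fun i _ => filter_subset _ _)
      (fun i hi i' hi' x hx => ?_) hm ?_
    · simp only [A, mem_filter] at hx ⊢
      exact ⟨hx.1, hmono i hi i' hi' hx.2⟩
    · rintro ⟨b, hb, hb'⟩
      refine hno ⟨fun i => (base (b i)).image σ, fun i hi => (mem_filter.1 (hb i hi)).2,
        fun i hi i' hi' => ?_⟩
      exact (disjoint_image (Equiv.injective σ)).2 (hdisj _ _ (hb' i hi i' hi'))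
  have hsumA : ∀ i ≤ s, m.choose l * ∑ σ, (A σ i).card = m * ((G i).card * m.factorial) := by
    intro i hi
    have h1 : ∑ σ, (A σ i).card =
        ∑ x ∈ range m, (univ.filter fun σ : Equiv.Perm α => (base x).image σ ∈ G i).card := by
      simp only [A, card_filter]
      exact sum_comm
    have h2 : ∀ x ∈ range m, m.choose l *
        (univ.filter fun σ : Equiv.Perm α => (base x).image σ ∈ G i).card =
        (G i).card * m.factorial := by
      intro x _
      rw [← hmα]
      exact choose_mul_card_perm_image_mem (hbase x) (hG i hi)
    rw [h1, mul_sum, sum_congr rfl h2, sum_const, card_range, smul_eq_mul]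
  have htot := Nat.mul_le_mul_left (m.choose l) (sum_le_sum fun σ (_ : σ ∈ univ) => hcirc σ)
  rw [sum_add_distrib, ← mul_sum, ← mul_sum, sum_comm, sum_const, card_univ, Fintype.card_perm,
    hmα, smul_eq_mul, mul_add, mul_left_comm, mul_sum, mul_left_comm _ (m - s * l),
    hsumA 0 (Nat.zero_le _), sum_congr rfl fun i hi => hsumA i (mem_Icc.1 hi).2] at htot
  rw [← mul_sum, ← sum_mul] at htot
  refine Nat.le_of_mul_le_mul_left (c := m * m.factorial) ?_
    (Nat.mul_pos hm0 (Nat.factorial_pos _))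
  linarith only [htot]

end Averaging

/-- The weighted inequality for chains of cross-dependent families, with a real weight. -/
theorem sum_card_add_mul_card_le {β : Type*} [DecidableEq β] {Y : Finset β} {l s : ℕ} {u : ℝ}
    {G : ℕ → Finset (Finset β)} (hs : 1 ≤ s) (hG : ∀ i ≤ s, G i ⊆ powersetCard l Y)
    (hmono : ∀ i ≤ s, ∀ i' ≤ i, G i' ⊆ G i) (hu : s ≤ u) (hm : (s + u) * l ≤ Y.card)
    (hno : ¬ ∃ B : ℕ → Finset β, (∀ i ≤ s, B i ∈ G i) ∧
      ∀ i ≤ s, ∀ i' < i, Disjoint (B i') (B i)) :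
    (∑ i ∈ Icc 1 s, ((G i).card : ℝ)) + u * (G 0).card ≤ s * Y.card.choose l := by
  -- The averaged inequality carries a factor `l`, hence is empty for `l = 0`; there `G 0 = ∅` and
  -- each |G i| ≤ 1.
  rcases Nat.eq_zero_or_pos l with rfl | hl
  · have h0 : G 0 = ∅ := by
      by_contra hne
      obtain ⟨B, hB⟩ := nonempty_iff_ne_empty.2 hne
      have hB0 : B = ∅ := card_eq_zero.1 (mem_powersetCard.1 (hG 0 (Nat.zero_le _) hB)).2
      exact hno ⟨fun _ => ∅, fun i hi => hmono i hi 0 (Nat.zero_le _) (hB0 ▸ hB),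
        fun _ _ _ _ => disjoint_empty_left _⟩
    have h1 : ∀ i ∈ Icc 1 s, ((G i).card : ℝ) ≤ 1 := by
      intro i hi
      have := card_le_card (hG i (mem_Icc.1 hi).2)
      rw [card_powersetCard, Nat.choose_zero_right] at this
      exact_mod_cast this
    have h2 := sum_le_card_nsmul _ _ _ h1
    rw [Nat.card_Icc, Nat.add_sub_cancel, nsmul_eq_mul] at h2
    rw [h0]
    simpa using h2
  · let ι : {x // x ∈ Y} ↪ β := Function.Embedding.subtype _
    let G' : ℕ → Finset (Finset {x // x ∈ Y}) := fun i => univ.filter fun B => B.map ι ∈ G i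
    have hcard : ∀ i ≤ s, (G' i).card = (G i).card := by
      intro i hi
      refine card_bij (fun B _ => B.map ι) (fun B hB => (mem_filter.1 hB).2)
        (fun B _ B' _ h => map_injective ι h) fun B hB => ?_
      have hBY := (mem_powersetCard.1 (hG i hi hB)).1
      have hmap : (B.subtype (· ∈ Y)).map ι = B := subtype_map_of_mem fun x hx => hBY hx
      exact ⟨B.subtype (· ∈ Y), mem_filter.2 ⟨mem_univ _, by rwa [hmap]⟩, hmap⟩
    have hY : Fintype.card {x // x ∈ Y} = Y.card := Fintype.card_coe Y
    have hl' : (0 : ℝ) < l := by exact_mod_cast hl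
    have hm' : 2 * s * l ≤ Y.card := by
      have : (2 * s * l : ℝ) ≤ Y.card := by nlinarith
      exact_mod_cast this
    have key := sum_card_le_of_cross_dependent (G := G') hl hs (fun i hi B hB => by
        have := (mem_powersetCard.1 (hG i hi (mem_filter.1 hB).2)).2
        rw [card_map] at this
        exact mem_powersetCard.2 ⟨subset_univ _, this⟩)
      (fun i hi i' hi' B hB => mem_filter.2 ⟨mem_univ _, hmono i hi i' hi' (mem_filter.1 hB).2⟩)
      (by rwa [hY]) (by
        rintro ⟨B, hB, hB'⟩
        exact hno ⟨fun i => (B i).map ι, fun i hi => (mem_filter.1 (hB i hi)).2,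
          fun i hi i' hi' => (disjoint_map ι).2 (hB' i hi i' hi')⟩)
    rw [hY, hcard 0 (Nat.zero_le _), sum_congr rfl fun i hi => hcard i (mem_Icc.1 hi).2] at key
    have hsl : s * l ≤ Y.card := le_trans (by nlinarith) hm'
    have key' : (l : ℝ) * ∑ i ∈ Icc 1 s, ((G i).card : ℝ) +
        ((Y.card : ℝ) - s * l) * (G 0).card ≤ s * l * Y.card.choose l := by
      have := (Nat.cast_le (α := ℝ)).2 key
      push_cast [Nat.cast_sub hsl] at this
      exact this
    have h3 : (u * l) * (G 0).card ≤ ((Y.card : ℝ) - s * l) * (G 0).card :=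
      mul_le_mul_of_nonneg_right (by linarith) (Nat.cast_nonneg _)
    refine le_of_mul_le_mul_left ?_ hl'
    linarith

/-! ### Links in a shifted family -/

/-- The sets `H ⊆ {a + 1, …, n}` with `Q ∪ H ∈ F`. -/
def link (n a : ℕ) (F : Finset (Finset ℕ)) (Q : Finset ℕ) : Finset (Finset ℕ) :=
  (Icc (a + 1) n).powerset.filter fun H => Q ∪ H ∈ F

section Link

variable {n k a : ℕ} {F : Finset (Finset ℕ)} {Q H : Finset ℕ}

theorem mem_link : H ∈ link n a F Q ↔ H ⊆ Icc (a + 1) n ∧ Q ∪ H ∈ F := by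
  simp [link]

theorem disjoint_of_subset_Icc (hQ : Q ⊆ Icc 1 a) (hH : H ⊆ Icc (a + 1) n) : Disjoint Q H :=
  disjoint_left.2 fun x hx hx' => by
    have h1 := mem_Icc.1 (hQ hx)
    have h2 := mem_Icc.1 (hH hx')
    omega

theorem card_add_card_of_mem_link (hF : F ⊆ powersetCard k (Icc 1 n)) (hQ : Q ⊆ Icc 1 a)
    (hH : H ∈ link n a F Q) : Q.card + H.card = k := by
  rw [mem_link] at hH
  rw [← card_union_of_disjoint (disjoint_of_subset_Icc hQ hH.1)]
  exact (mem_powersetCard.1 (hF hH.2)).2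

theorem card_link (hF : F ⊆ powersetCard k (Icc 1 n)) (hQ : Q ⊆ Icc 1 a) :
    (link n a F Q).card = (F.filter fun A => A ∩ Icc 1 a = Q).card := by
  refine card_bij (fun H _ => Q ∪ H) (fun H hH => ?_) (fun H hH H' hH' h => ?_) fun A hA => ?_
  · rw [mem_link] at hH
    refine mem_filter.2 ⟨hH.2, ?_⟩
    rw [union_inter_distrib_right, inter_eq_left.2 hQ,
      disjoint_iff_inter_eq_empty.1 (disjoint_of_subset_Icc Subset.rfl hH.1).symm, union_empty]
  · rw [mem_link] at hH hH'
    have h1 := union_sdiff_cancel_left (disjoint_of_subset_Icc hQ hH.1)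
    have h2 := union_sdiff_cancel_left (disjoint_of_subset_Icc hQ hH'.1)
    have h' : Q ∪ H = Q ∪ H' := h
    rw [← h1, h', h2]
  · obtain ⟨hA', rfl⟩ := mem_filter.1 hA
    have hun : (A ∩ Icc 1 a) ∪ (A \ Icc 1 a) = A := by
      rw [union_comm, sdiff_union_inter]
    refine ⟨A \ Icc 1 a, mem_link.2 ⟨fun x hx => ?_, by rwa [hun]⟩, hun⟩
    rw [mem_sdiff] at hx
    have h1 := mem_Icc.1 ((mem_powersetCard.1 (hF hA')).1 hx.1)
    have h2 := hx.2
    rw [mem_Icc] at h2 ⊢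
    omega

theorem link_insert_subset_link_insert (hS : Shifted F) {x y : ℕ} (hx : 1 ≤ x) (hxy : x < y)
    (hy : y ≤ a) (hxQ : x ∉ Q) (hyQ : y ∉ Q) :
    link n a F (insert y Q) ⊆ link n a F (insert x Q) := by
  intro H hH
  rw [mem_link] at hH ⊢
  have hnot : ∀ z ≤ a, z ∉ H := fun z hz h => by
    have := mem_Icc.1 (hH.1 h); omega
  refine ⟨hH.1, ?_⟩
  have h := hS _ hH.2 x y hx hxy (by simp) (by
    simp [hxQ, hxy.ne, hnot x (by omega)])
  rwa [insert_union, erase_insert (by simp [hyQ, hnot y hy]), ← insert_union] at h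

/-- The deleted element exceeds `a`, so it may be shifted down to `x`. -/
theorem shadow_link_subset (hS : Shifted F) {x : ℕ} (hx : 1 ≤ x) (hxa : x ≤ a) (hxQ : x ∉ Q)
    (hQ : Q ⊆ Icc 1 a) : (link n a F Q).shadow ⊆ link n a F (insert x Q) := by
  intro B hB
  obtain ⟨H, hH, y, hy, rfl⟩ := mem_shadow_iff.1 hB
  rw [mem_link] at hH ⊢
  have hya := mem_Icc.1 (hH.1 hy)
  have hnot : x ∉ H := fun h => by
    have := mem_Icc.1 (hH.1 h); omega
  have hyQ : y ∉ Q := fun h => by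
    have := mem_Icc.1 (hQ h); omega
  refine ⟨(erase_subset _ _).trans hH.1, ?_⟩
  have h := hS _ hH.2 x y hx (by omega) (by simp [hy]) (by simp [hxQ, hnot])
  rwa [erase_union_distrib, erase_eq_of_notMem hyQ, ← insert_union] at h

/-- If all members of the link of `Q` were avoiding the initial segments, then the family would
contain `s + 1` sets containing `Q` and otherwise disjoint. -/
theorem exists_le_card_inter_of_mem_link (hF : F ⊆ powersetCard k (Icc 1 n)) (hS : Shifted F)
    {s q : ℕ} (hU : PropertyU (s + 1) q F) (hQ : Q ⊆ Icc 1 a)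
    (hq : q < Q.card + (k - Q.card) * (s + 1)) (hH : H ∈ link n a F Q) :
    ∃ i, 1 ≤ i ∧ i ≤ (H ∩ Ioo a (a + i * (s + 1))).card := by
  by_contra! hcon
  have hcard := card_add_card_of_mem_link hF hQ hH
  rw [mem_link] at hH
  obtain ⟨d, hd⟩ : ∃ d, H.card = d := ⟨_, rfl⟩
  rw [hd] at hcard
  -- These progressions partition the first d(s+1) integers above `a`. By `hcon` the t-th element of
  -- `H` is at least a + t(s+1), hence at least the t-th element of each `C c`; shiftedness puts
  -- every `Q ∪ C c` into `F`.
  let C : Fin (s + 1) → Finset ℕ := fun c =>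
    (range d).image fun e => a + 1 + (e * (s + 1) + c)
  have hinj : ∀ c : Fin (s + 1), Function.Injective fun e => a + 1 + (e * (s + 1) + c) := by
    intro c e e' h
    have h' : e * (s + 1) = e' * (s + 1) := by
      have : a + 1 + (e * (s + 1) + c) = a + 1 + (e' * (s + 1) + c) := h
      omega
    exact Nat.eq_of_mul_eq_mul_right (Nat.succ_pos s) h'
  have hCcard : ∀ c, (C c).card = d := fun c => by
    rw [card_image_of_injective _ (hinj c), card_range]
  have hQC : ∀ c, Disjoint Q (C c) := by
    intro c
    rw [disjoint_left]
    intro x hx hx'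
    obtain ⟨e, -, rfl⟩ := mem_image.1 hx'
    have := mem_Icc.1 (hQ hx)
    omega
  have hQH := disjoint_of_subset_Icc hQ hH.1
  have hmem : ∀ c, Q ∪ C c ∈ F := by
    intro c
    refine hS.mem_of_dominated hH.2 (fun x hx => ?_) ?_ fun N => ?_
    · rcases mem_union.1 hx with h | h
      · exact (mem_Icc.1 (hQ h)).1
      · obtain ⟨e, -, rfl⟩ := mem_image.1 h
        omega
    · rw [card_union_of_disjoint hQH, card_union_of_disjoint (hQC c), hCcard, hd]
    · rw [filter_union, filter_union,
        card_union_of_disjoint (disjoint_filter_filter hQH),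
        card_union_of_disjoint (disjoint_filter_filter (hQC c))]
      refine Nat.add_le_add_left ?_ _
      obtain ⟨t, ht⟩ : ∃ t, (H.filter (· ≤ N)).card = t := ⟨_, rfl⟩
      rw [ht]
      rcases Nat.eq_zero_or_pos t with h0 | hpos
      · omega
      · have htd : t ≤ d := by rw [← ht, ← hd]; exact card_filter_le _ _
        have hN : a + t * (s + 1) ≤ N := by
          by_contra hlt
          have h1 := hcon t hpos
          refine absurd (card_le_card (fun x hx => ?_) :
            (H.filter (· ≤ N)).card ≤ (H ∩ Ioo a (a + t * (s + 1))).card) (by omega)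
          rw [mem_filter] at hx
          have := mem_Icc.1 (hH.1 hx.1)
          rw [mem_inter, mem_Ioo]
          exact ⟨hx.1, by omega, by omega⟩
        have h2 : ((range t).image fun e => a + 1 + (e * (s + 1) + c)).card = t := by
          rw [card_image_of_injective _ (hinj c), card_range]
        refine h2.ge.trans (card_le_card fun x hx => ?_)
        obtain ⟨e, he, rfl⟩ := mem_image.1 hx
        rw [mem_range] at he
        refine mem_filter.2 ⟨mem_image.2 ⟨e, mem_range.2 (by omega), rfl⟩, ?_⟩
        have h3 : (e + 1) * (s + 1) ≤ t * (s + 1) := Nat.mul_le_mul_right _ he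
        have h4 := c.2
        rw [add_mul] at h3
        omega
  have hle := hU (fun c => Q ∪ C c) hmem
  have hsub : Q ∪ Ioc a (a + d * (s + 1)) ⊆ univ.biUnion fun c => Q ∪ C c := by
    intro x hx
    rw [mem_biUnion]
    rcases mem_union.1 hx with h | h
    · exact ⟨0, mem_univ _, mem_union_left _ h⟩
    · rw [mem_Ioc] at h
      refine ⟨⟨(x - a - 1) % (s + 1), Nat.mod_lt _ (Nat.succ_pos s)⟩, mem_univ _,
        mem_union_right _ (mem_image.2 ⟨(x - a - 1) / (s + 1), ?_, ?_⟩)⟩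
      · have := Nat.mul_comm d (s + 1)
        exact mem_range.2 (Nat.div_lt_of_lt_mul (by omega))
      · have := Nat.div_add_mod' (x - a - 1) (s + 1)
        dsimp only
        omega
  have h5 := (card_le_card hsub).trans hle
  rw [card_union_of_disjoint (disjoint_left.2 fun x hx hx' => by
    have h6 := mem_Icc.1 (hQ hx); have h7 := mem_Ioc.1 hx'; omega), Nat.card_Ioc] at h5
  have h8 : k - Q.card = d := by omega
  rw [h8] at hq
  omega

theorem card_link_le_mul_card_link_insert (hF : F ⊆ powersetCard k (Icc 1 n)) (hS : Shifted F)
    {s q : ℕ} (hU : PropertyU (s + 1) q F) (hQ : Q ⊆ Icc 1 a)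
    (hq : q < Q.card + (k - Q.card) * (s + 1)) {x : ℕ} (hx : 1 ≤ x) (hxa : x ≤ a)
    (hxQ : x ∉ Q) : (link n a F Q).card ≤ s * (link n a F (insert x Q)).card :=
  (card_le_mul_card_shadow (a := a) fun _ hH =>
    exists_le_card_inter_of_mem_link hF hS hU hQ hq hH).trans
    (Nat.mul_le_mul_left _ (card_le_card (shadow_link_subset hS hx hxa hxQ hQ)))

end Link

/-! ### The weighted inequality for links -/

/-- A nonempty finite set of integers, listed in decreasing order with the minimum repeated. -/
theorem exists_antitone_enumeration {Z : Finset ℕ} {d : ℕ} (hZ : Z.card = d) (hd : 1 ≤ d) :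
    ∃ y : ℕ → ℕ, (∀ i, y i ∈ Z) ∧ (∀ i i', 1 ≤ i' → i' ≤ i → y i ≤ y i') ∧
      (∀ i, d ≤ i → y i = y d) ∧ Set.BijOn y (Icc 1 d : Finset ℕ) Z := by
  refine ⟨fun i => Z.orderEmbOfFin hZ ⟨d - max 1 (min i d), by omega⟩,
    fun i => orderEmbOfFin_mem _ _ _, fun i i' _ _ => ?_, fun i hi => ?_, ?_, ?_, ?_⟩
  · exact (Z.orderEmbOfFin hZ).monotone (Fin.mk_le_mk.2 (by omega))
  · simp [hi]
  · exact fun i _ => orderEmbOfFin_mem _ _ _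
  · intro i hi i' hi' h
    rw [mem_coe, mem_Icc] at hi hi'
    have := Fin.mk.inj_iff.1 ((Z.orderEmbOfFin hZ).injective h)
    omega
  · intro x hx
    rw [← range_orderEmbOfFin Z hZ] at hx
    obtain ⟨⟨j, hj⟩, rfl⟩ := hx
    refine ⟨d - j, by rw [mem_coe, mem_Icc]; omega, ?_⟩
    dsimp only
    congr 2
    omega

section Main

variable {n k s p r : ℕ} {F : Finset (Finset ℕ)}

/-- The weighted inequality for the links of the `r`-sets containing a given `(r - 1)`-set. -/
theorem sum_card_link_insert_add_le (hr : 1 ≤ r) (hrp : r ≤ p) (hps : p ≤ s + r - 1)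
    (hrk : r ≤ k) (hpn : p + 1 ≤ n)
    (hF : F ⊆ powersetCard k (Icc 1 n)) (hS : Shifted F)
    (hU : PropertyU (s + 1) ((k - r) * (s + 1) + p) F) {u : ℝ} (hu : (s : ℝ) ≤ u)
    (hn : (s + u) * ((k - r : ℕ) : ℝ) ≤ ((n - (p + 1) : ℕ) : ℝ)) {T : Finset ℕ}
    (hT : T ∈ powersetCard (r - 1) (Icc 1 p)) :
    (s : ℝ) * ∑ x ∈ Icc 1 p \ T, ((link n (p + 1) F (insert x T)).card : ℝ) +
      ((p + 1 - r : ℕ) : ℝ) * (u * (link n (p + 1) F (insert (p + 1) T)).card) ≤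
      ((p + 1 - r : ℕ) : ℝ) * (s * (n - (p + 1)).choose (k - r)) := by
  obtain ⟨hTp, hTc⟩ := mem_powersetCard.1 hT
  obtain ⟨d, hd⟩ : ∃ d, p + 1 - r = d := ⟨_, rfl⟩
  rw [hd]
  have hZ : (Icc 1 p \ T).card = d := by
    rw [card_sdiff_of_subset hTp, hTc, Nat.card_Icc]; omega
  obtain ⟨y, hyZ, hyanti, hyd, hybij⟩ := exists_antitone_enumeration hZ (by omega)
  have hyp : ∀ i, 1 ≤ y i ∧ y i ≤ p ∧ y i ∉ T := by
    intro i
    have h := mem_sdiff.1 (hyZ i)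
    have h' := mem_Icc.1 h.1
    exact ⟨h'.1, h'.2, h.2⟩
  have hpT : p + 1 ∉ T := fun h => by have := mem_Icc.1 (hTp h); omega
  -- The largest element comes first, so its link is least in the chain and receives the weight `u`.
  -- Since p ≤ s + r - 1, the indices 1, …, s exhaust [p] \ T.
  let z : ℕ → ℕ := fun i => if i = 0 then p + 1 else y i
  have hz0 : z 0 = p + 1 := rfl
  have hz1 : ∀ i, 1 ≤ i → z i = y i := fun i hi => if_neg (by omega)
  have hz : ∀ i, 1 ≤ z i ∧ z i ≤ p + 1 ∧ z i ∉ T := by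
    intro i
    rcases Nat.eq_zero_or_pos i with rfl | hi
    · exact ⟨by omega, le_rfl, hpT⟩
    · rw [hz1 i hi]
      have := hyp i
      exact ⟨this.1, by omega, this.2.2⟩
  have hzanti : ∀ i i', i' ≤ i → z i ≤ z i' := by
    intro i i' hii
    rcases Nat.eq_zero_or_pos i' with rfl | hi
    · exact (hz i).2.1
    · rw [hz1 i' hi, hz1 i (by omega)]
      exact hyanti i i' hi hii
  have hQ : ∀ i, insert (z i) T ⊆ Icc 1 (p + 1) := fun i =>
    insert_subset (mem_Icc.2 ⟨(hz i).1, (hz i).2.1⟩)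
      (hTp.trans (Icc_subset_Icc_right (Nat.le_succ p)))
  have hQc : ∀ i, (insert (z i) T).card = r := fun i => by
    rw [card_insert_of_notMem (hz i).2.2, hTc]; omega
  have hYc : (Icc (p + 1 + 1) n).card = n - (p + 1) := by rw [Nat.card_Icc]; omega
  have main := sum_card_add_mul_card_le (Y := Icc (p + 1 + 1) n) (l := k - r) (s := s) (u := u)
    (G := fun i => link n (p + 1) F (insert (z i) T)) (by omega)
    (fun i _ H hH => mem_powersetCard.2 ⟨(mem_link.1 hH).1, by
      have := card_add_card_of_mem_link hF (hQ i) hH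
      rw [hQc] at this
      omega⟩)
    (fun i _ i' hi' => by
      rcases (hzanti i i' hi').eq_or_lt with h | h
      · rw [h]
      · exact link_insert_subset_link_insert hS (hz i).1 h (hz i').2.1 (hz i).2.2 (hz i').2.2)
    hu (by rwa [hYc]) (by
      -- Disjoint representatives would yield a union containing [p+1] and (s+1)(k-r) further
      -- points, one more than allowed.
      rintro ⟨B, hB, hB'⟩
      have hmem : ∀ i ≤ s, insert (z i) T ∪ B i ∈ F := fun i hi => (mem_link.1 (hB i hi)).2
      have hBs : ∀ i ≤ s, B i ⊆ Icc (p + 1 + 1) n := fun i hi => (mem_link.1 (hB i hi)).1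
      have hBc : ∀ i ≤ s, (B i).card = k - r := by
        intro i hi
        have := card_add_card_of_mem_link hF (hQ i) (hB i hi)
        rw [hQc] at this
        omega
      have hle := hU (fun i : Fin (s + 1) => insert (z i) T ∪ B i)
        fun i => hmem i (Nat.lt_succ_iff.1 i.2)
      have hsub : Icc 1 (p + 1) ∪ (range (s + 1)).biUnion B ⊆
          univ.biUnion fun i : Fin (s + 1) => insert (z i) T ∪ B i := by
        intro x hx
        rw [mem_biUnion]
        rcases mem_union.1 hx with h | h
        · by_cases hxT : x ∈ T
          · exact ⟨0, mem_univ _, mem_union_left _ (mem_insert_of_mem hxT)⟩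
          · rw [mem_Icc] at h
            by_cases hxp : x = p + 1
            · exact ⟨0, mem_univ _, mem_union_left _ (mem_insert.2 (Or.inl hxp))⟩
            · have hxZ : x ∈ ((Icc 1 p \ T : Finset ℕ) : Set ℕ) := by
                rw [mem_coe, mem_sdiff, mem_Icc]
                exact ⟨⟨h.1, by omega⟩, hxT⟩
              obtain ⟨i, hi, rfl⟩ := hybij.surjOn hxZ
              rw [mem_coe, mem_Icc] at hi
              refine ⟨⟨i, by omega⟩, mem_univ _, mem_union_left _ ?_⟩
              dsimp only
              rw [hz1 i hi.1]
              exact mem_insert_self _ _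
        · obtain ⟨i, hi, hxi⟩ := mem_biUnion.1 h
          exact ⟨⟨i, mem_range.1 hi⟩, mem_univ _, mem_union_right _ hxi⟩
      have hcard := (card_le_card hsub).trans hle
      have hdis : Disjoint (Icc 1 (p + 1)) ((range (s + 1)).biUnion B) := by
        rw [disjoint_biUnion_right]
        exact fun i hi => disjoint_of_subset_Icc Subset.rfl
          (hBs i (Nat.lt_succ_iff.1 (mem_range.1 hi)))
      have hpair : ((range (s + 1) : Finset ℕ) : Set ℕ).PairwiseDisjoint B := by
        intro i hi i' hi' hne
        rw [mem_coe, mem_range] at hi hi'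
        rcases lt_or_gt_of_ne hne with h | h
        · exact hB' i' (by omega) i h
        · exact (hB' i (by omega) i' h).symm
      rw [card_union_of_disjoint hdis, card_biUnion hpair,
        sum_congr rfl fun i hi => hBc i (Nat.lt_succ_iff.1 (mem_range.1 hi)), sum_const,
        card_range, smul_eq_mul, Nat.card_Icc] at hcard
      have hcomm : (s + 1) * (k - r) = (k - r) * (s + 1) := mul_comm _ _
      simp only [Nat.succ_eq_add_one] at hcard
      omega)
  rw [hYc] at main
  rw [hz0, sum_congr rfl fun i hi => by rw [hz1 i (mem_Icc.1 hi).1]] at main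
  let g : ℕ → ℝ := fun x => ((link n (p + 1) F (insert x T)).card : ℝ)
  have hganti : ∀ i, 1 ≤ i → i ≤ d → g (y i) ≤ g (y d) := by
    intro i hi hid
    have h := hzanti d i hid
    rw [hz1 d (by omega), hz1 i hi] at h
    rcases h.eq_or_lt with h | h
    · rw [h]
    · exact Nat.cast_le.2 (card_le_card (link_insert_subset_link_insert hS (hyp d).1 h
        (by have := hyp i; omega) (hyp d).2.2 (hyp i).2.2))
  have hsumZ : ∑ i ∈ Icc 1 d, g (y i) = ∑ x ∈ Icc 1 p \ T, g x :=
    sum_nbij y (fun i _ => hyZ i) hybij.injOn hybij.surjOn fun _ _ => rfl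
  have hds : d ≤ s := by omega
  have hsplit : ∑ i ∈ Icc 1 s, g (y i) = ∑ x ∈ Icc 1 p \ T, g x + ((s : ℝ) - d) * g (y d) := by
    have hun : Icc 1 s = Icc 1 d ∪ Ioc d s := by
      ext x; simp only [mem_Icc, mem_union, mem_Ioc]; omega
    have htail : ∀ i ∈ Ioc d s, g (y i) = g (y d) := fun i hi =>
      congrArg g (hyd i (mem_Ioc.1 hi).1.le)
    rw [hun, sum_union (disjoint_left.2 fun x hx hx' => by
      rw [mem_Icc] at hx; rw [mem_Ioc] at hx'; omega), hsumZ,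
      sum_congr rfl htail, sum_const, Nat.card_Ioc,
      nsmul_eq_mul, Nat.cast_sub hds]
  -- The repeated minimum has the largest link, so after multiplication by `d` its s - d extra
  -- copies outweigh s - d copies of the whole sum.
  have havg : ∑ x ∈ Icc 1 p \ T, g x ≤ d * g (y d) := by
    rw [← hsumZ]
    have := sum_le_card_nsmul (Icc 1 d) (fun i => g (y i)) (g (y d)) fun i hi =>
      hganti i (mem_Icc.1 hi).1 (mem_Icc.1 hi).2
    rwa [Nat.card_Icc, nsmul_eq_mul, Nat.add_sub_cancel] at this
  have hmain : (∑ x ∈ Icc 1 p \ T, g x + ((s : ℝ) - d) * g (y d)) + u * g (p + 1) ≤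
      s * (n - (p + 1)).choose (k - r) := hsplit ▸ main
  have h1 := mul_le_mul_of_nonneg_left hmain (Nat.cast_nonneg (α := ℝ) d)
  have h2 := mul_le_mul_of_nonneg_left havg
    (sub_nonneg.2 ((Nat.cast_le (α := ℝ)).2 hds))
  change (s : ℝ) * ∑ x ∈ Icc 1 p \ T, g x + (d : ℝ) * (u * g (p + 1)) ≤ _
  linarith

end Main

/-! ### Counting by traces -/

theorem sum_powersetCard_sum_insert {M : Type*} [AddCommMonoid M] (X : Finset ℕ) (j : ℕ)
    (g : Finset ℕ → M) :
    ∑ T ∈ powersetCard j X, ∑ x ∈ X \ T, g (insert x T) =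
      (j + 1) • ∑ Q ∈ powersetCard (j + 1) X, g Q := by
  have h : ∀ Q ∈ powersetCard (j + 1) X, ∑ _x ∈ Q, g Q = (j + 1) • g Q := fun Q hQ => by
    rw [sum_const, (mem_powersetCard.1 hQ).2]
  rw [smul_sum, ← sum_congr rfl h, sum_sigma', sum_sigma']
  refine sum_bij' (fun a _ => ⟨insert a.2 a.1, a.2⟩) (fun b _ => ⟨b.1.erase b.2, b.2⟩)
    ?_ ?_ ?_ ?_ ?_
  · rintro ⟨T, x⟩ h
    simp only [mem_sigma, mem_powersetCard, mem_sdiff] at h ⊢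
    exact ⟨⟨insert_subset h.2.1 h.1.1, by rw [card_insert_of_notMem h.2.2, h.1.2]⟩,
      mem_insert_self _ _⟩
  · rintro ⟨Q, x⟩ h
    simp only [mem_sigma, mem_powersetCard, mem_sdiff] at h ⊢
    exact ⟨⟨(erase_subset _ _).trans h.1.1, by rw [card_erase_of_mem h.2, h.1.2]; rfl⟩,
      h.1.1 h.2, notMem_erase _ _⟩
  · rintro ⟨T, x⟩ h
    simp only [mem_sigma, mem_sdiff] at h
    simp only [erase_insert h.2.2]
  · rintro ⟨Q, x⟩ h
    simp only [mem_sigma] at h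
    simp only [insert_erase h.2]
  · rintro ⟨T, x⟩ h
    rfl

section Counting

variable {n k s p r : ℕ} {F : Finset (Finset ℕ)}

/-- The number of sets in `F` meeting `[p]` in `j` elements and avoiding `p + 1`. -/
def avoidCount (n p : ℕ) (F : Finset (Finset ℕ)) (j : ℕ) : ℕ :=
  ∑ Q ∈ powersetCard j (Icc 1 p), (link n (p + 1) F Q).card

/-- The number of sets in `F` meeting `[p]` in `j` elements and containing `p + 1`. -/
def containCount (n p : ℕ) (F : Finset (Finset ℕ)) (j : ℕ) : ℕ :=
  ∑ T ∈ powersetCard j (Icc 1 p), (link n (p + 1) F (insert (p + 1) T)).card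

/-- Each element dropped from the trace raises the right side by s, and r - 1 already gives
(k-r)(s+1) + r + s, which exceeds the left side. -/
theorem lt_card_add_mul (hrk : r ≤ k) (hps : p ≤ s + r - 1) {j : ℕ} (hj : j < r) :
    (k - r) * (s + 1) + p < j + (k - j) * (s + 1) := by
  obtain ⟨c, rfl⟩ := Nat.exists_eq_add_of_le hrk
  obtain ⟨e, rfl⟩ := Nat.exists_eq_add_of_lt hj
  have h1 : j + e + 1 + c - (j + e + 1) = c := by omega
  have h2 : j + e + 1 + c - j = c + e + 1 := by omega
  have h3 : (c + e + 1) * (s + 1) = c * (s + 1) + e * s + e + s + 1 := by ring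
  rw [h1, h2, h3]
  omega

theorem avoidCount_le (hrk : r ≤ k) (hps : p ≤ s + r - 1)
    (hF : F ⊆ powersetCard k (Icc 1 n)) (hS : Shifted F)
    (hU : PropertyU (s + 1) ((k - r) * (s + 1) + p) F) {j : ℕ} (hj : j < r) :
    avoidCount n p F j ≤ s * containCount n p F j := by
  rw [avoidCount, containCount, mul_sum]
  refine sum_le_sum fun Q hQ => ?_
  obtain ⟨hQp, hQc⟩ := mem_powersetCard.1 hQ
  exact card_link_le_mul_card_link_insert hF hS hU
    (hQp.trans (Icc_subset_Icc_right (Nat.le_succ p)))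
    (by rw [hQc]; exact lt_card_add_mul hrk hps hj) (by omega) le_rfl
    fun h => by have := mem_Icc.1 (hQp h); omega

/-- Each of the p - j ways to enlarge T inside [p] costs a factor s, and each (j+1)-set arises j + 1
times. -/
theorem sub_mul_containCount_le (hrk : r ≤ k) (hps : p ≤ s + r - 1)
    (hF : F ⊆ powersetCard k (Icc 1 n)) (hS : Shifted F)
    (hU : PropertyU (s + 1) ((k - r) * (s + 1) + p) F) {j : ℕ} (hj : j + 1 < r) :
    (p - j) * containCount n p F j ≤ s * ((j + 1) * containCount n p F (j + 1)) := by
  have h := sum_powersetCard_sum_insert (Icc 1 p) j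
    fun Q => (link n (p + 1) F (insert (p + 1) Q)).card
  rw [smul_eq_mul] at h
  rw [containCount, containCount, ← h, mul_sum, mul_sum]
  refine sum_le_sum fun T hT => ?_
  obtain ⟨hTp, hTc⟩ := mem_powersetCard.1 hT
  have hpT : p + 1 ∉ T := fun h => by have := mem_Icc.1 (hTp h); omega
  have hc : (Icc 1 p \ T).card = p - j := by
    rw [card_sdiff_of_subset hTp, hTc, Nat.card_Icc]; omega
  rw [← hc, ← smul_eq_mul, mul_sum]
  refine card_nsmul_le_sum _ _ _ fun x hx => ?_
  obtain ⟨hx, hxT⟩ := mem_sdiff.1 hx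
  rw [mem_Icc] at hx
  rw [insert_comm]
  refine card_link_le_mul_card_link_insert hF hS hU
    (insert_subset (mem_Icc.2 (by omega)) (hTp.trans (Icc_subset_Icc_right (Nat.le_succ p))))
    ?_ hx.1 (by omega) ?_
  · rw [card_insert_of_notMem hpT, hTc]
    exact lt_card_add_mul hrk hps hj
  · rw [mem_insert]
    rintro (h | h)
    · omega
    · exact hxT h

/-- The previous step is iterated up to r - 1; the factors telescope by (p-j)·C(p,j) =
(j+1)·C(p,j+1). -/
theorem containCount_mul_choose_le (hrp : r ≤ p) (hrk : r ≤ k) (hps : p ≤ s + r - 1)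
    (hF : F ⊆ powersetCard k (Icc 1 n)) (hS : Shifted F)
    (hU : PropertyU (s + 1) ((k - r) * (s + 1) + p) F) {i j : ℕ} (hij : j + i + 1 = r) :
    containCount n p F j * p.choose (r - 1) ≤
      s ^ i * p.choose j * containCount n p F (r - 1) := by
  induction i generalizing j with
  | zero =>
    obtain rfl : j = r - 1 := by omega
    rw [pow_zero, one_mul, mul_comm]
  | succ i ih =>
    have h1 := ih (j := j + 1) (by omega)
    have h2 := sub_mul_containCount_le hrk hps hF hS hU (j := j) (by omega)
    have h3 := Nat.choose_succ_right_eq p j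
    refine Nat.le_of_mul_le_mul_left (c := p - j) ?_ (by omega)
    calc (p - j) * (containCount n p F j * p.choose (r - 1))
        = (p - j) * containCount n p F j * p.choose (r - 1) := by ring
      _ ≤ s * ((j + 1) * containCount n p F (j + 1)) * p.choose (r - 1) :=
          Nat.mul_le_mul_right _ h2
      _ = s * (j + 1) * (containCount n p F (j + 1) * p.choose (r - 1)) := by ring
      _ ≤ s * (j + 1) * (s ^ i * p.choose (j + 1) * containCount n p F (r - 1)) :=
          Nat.mul_le_mul_left _ h1
      _ = s ^ (i + 1) * (p.choose (j + 1) * (j + 1)) * containCount n p F (r - 1) := by ring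
      _ = (p - j) * (s ^ (i + 1) * p.choose j * containCount n p F (r - 1)) := by
          rw [h3]; ring

theorem sum_counts_mul_choose_le (hrp : r ≤ p) (hrk : r ≤ k) (hps : p ≤ s + r - 1)
    (hF : F ⊆ powersetCard k (Icc 1 n)) (hS : Shifted F)
    (hU : PropertyU (s + 1) ((k - r) * (s + 1) + p) F) :
    (∑ j ∈ range r, (avoidCount n p F j + containCount n p F j)) * p.choose (r - 1) ≤
      (s + 1) * (∑ j ∈ range r, s ^ (r - 1 - j) * p.choose j) *
        containCount n p F (r - 1) := by
  rw [sum_mul, mul_sum, sum_mul]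
  refine sum_le_sum fun j hj => ?_
  rw [mem_range] at hj
  have h1 := avoidCount_le hrk hps hF hS hU hj
  have h2 := containCount_mul_choose_le hrp hrk hps hF hS hU (i := r - 1 - j) (j := j) (by omega)
  calc (avoidCount n p F j + containCount n p F j) * p.choose (r - 1)
      ≤ (s * containCount n p F j + containCount n p F j) * p.choose (r - 1) := by gcongr
    _ = (s + 1) * (containCount n p F j * p.choose (r - 1)) := by ring
    _ ≤ (s + 1) * (s ^ (r - 1 - j) * p.choose j * containCount n p F (r - 1)) :=
        Nat.mul_le_mul_left _ h2
    _ = _ := by ring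

/-- This admits f as the weight `u`. The summand j = r - 1 suffices, because C(p,r) ≤ s·C(p,r-1). -/
theorem le_f (hr : 1 ≤ r) (hrp : r ≤ p) (hps : p ≤ s + r - 1) : (s : ℝ) ≤ f s p r := by
  have hpos : (0 : ℝ) < p.choose r := by exact_mod_cast Nat.choose_pos hrp
  have h1 : p.choose r ≤ s * p.choose (r - 1) := by
    have h := Nat.choose_succ_right_eq p (r - 1)
    rw [Nat.sub_add_cancel hr] at h
    calc p.choose r ≤ p.choose r * r := Nat.le_mul_of_pos_right _ hr
      _ = p.choose (r - 1) * (p - (r - 1)) := h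
      _ ≤ p.choose (r - 1) * s := Nat.mul_le_mul_left _ (by omega)
      _ = _ := mul_comm _ _
  have h2 : (p.choose (r - 1) : ℝ) ≤
      ∑ j ∈ range r, (s : ℝ) ^ (r - 1 - j) * (p.choose j : ℝ) := by
    have := single_le_sum (f := fun j => (s : ℝ) ^ (r - 1 - j) * (p.choose j : ℝ))
      (fun j _ => by positivity) (mem_range.2 (by omega : r - 1 < r))
    simpa using this
  have h3 : (p.choose r : ℝ) ≤ s * p.choose (r - 1) := by exact_mod_cast h1
  rw [f, mul_assoc]
  refine le_mul_of_one_le_right (Nat.cast_nonneg _) ?_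
  rw [← mul_div_assoc, one_le_div hpos]
  have hs : (0 : ℝ) ≤ s := Nat.cast_nonneg _
  nlinarith [mul_le_mul_of_nonneg_left h2 hs, (Nat.cast_nonneg _ : (0 : ℝ) ≤ p.choose (r - 1))]

/-- The sets outside the part common to all extremal competitors are few. -/
theorem avoidCount_add_sum_counts_le (hr : 1 ≤ r) (hrk : r ≤ k) (hrp : r ≤ p)
    (hps : p ≤ s + r - 1) (hpn : p + 1 ≤ n)
    (hF : F ⊆ powersetCard k (Icc 1 n)) (hS : Shifted F)
    (hU : PropertyU (s + 1) ((k - r) * (s + 1) + p) F)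
    (hn : (s + f s p r) * ((k - r : ℕ) : ℝ) ≤ ((n - (p + 1) : ℕ) : ℝ)) :
    avoidCount n p F r + ∑ j ∈ range r, (avoidCount n p F j + containCount n p F j) ≤
      p.choose r * (n - (p + 1)).choose (k - r) := by
  have hs : 1 ≤ s := by omega
  have hlow := sum_counts_mul_choose_le hrp hrk hps hF hS hU
  have hsum := sum_le_sum fun T hT =>
    sum_card_link_insert_add_le hr hrp hps hrk hpn hF hS hU (le_f hr hrp hps) hn (T := T) hT
  have hpair := sum_powersetCard_sum_insert (Icc 1 p) (r - 1)
    fun Q => ((link n (p + 1) F Q).card : ℝ)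
  rw [Nat.sub_add_cancel hr, nsmul_eq_mul] at hpair
  rw [sum_add_distrib, ← mul_sum, hpair, ← mul_sum, ← mul_sum, sum_const, card_powersetCard,
    Nat.card_Icc, Nat.add_sub_cancel, nsmul_eq_mul] at hsum
  have hchoose : p.choose r * r = p.choose (r - 1) * (p + 1 - r) := by
    have h := Nat.choose_succ_right_eq p (r - 1)
    rw [Nat.sub_add_cancel hr] at h
    rw [h]
    congr 1
    omega
  have hchoose' : (p.choose r : ℝ) * r = p.choose (r - 1) * ((p + 1 - r : ℕ) : ℝ) := by
    exact_mod_cast hchoose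
  have hpos : (0 : ℝ) < p.choose r := by exact_mod_cast Nat.choose_pos hrp
  have hpos1 : (0 : ℝ) < p.choose (r - 1) := by
    exact_mod_cast Nat.choose_pos (by omega : r - 1 ≤ p)
  have hf : f s p r * p.choose r =
      s * (s + 1) * ∑ j ∈ range r, (s : ℝ) ^ (r - 1 - j) * (p.choose j : ℝ) := by
    rw [f, mul_assoc, div_mul_cancel₀ _ hpos.ne']
  have hlow' : ((∑ j ∈ range r, (avoidCount n p F j + containCount n p F j) : ℕ) : ℝ) *
      p.choose (r - 1) ≤ (s + 1) * (∑ j ∈ range r, (s : ℝ) ^ (r - 1 - j) * (p.choose j : ℝ)) *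
        (containCount n p F (r - 1) : ℕ) := by
    exact_mod_cast hlow
  have hA : ∑ Q ∈ powersetCard r (Icc 1 p), ((link n (p + 1) F Q).card : ℝ) =
      (avoidCount n p F r : ℕ) := by rw [avoidCount]; push_cast; rfl
  have hB : ∑ T ∈ powersetCard (r - 1) (Icc 1 p),
      ((link n (p + 1) F (insert (p + 1) T)).card : ℝ) = (containCount n p F (r - 1) : ℕ) := by
    rw [containCount]; push_cast; rfl
  rw [hA, hB] at hsum
  have hs' : (0 : ℝ) < s := by exact_mod_cast hs
  have hr' : (0 : ℝ) < r := by exact_mod_cast hr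
  rw [← Nat.cast_le (α := ℝ), Nat.cast_add]
  push_cast only [Nat.cast_mul]
  generalize ((∑ j ∈ range r, (avoidCount n p F j + containCount n p F j) : ℕ) : ℝ) = L at *
  generalize ∑ j ∈ range r, (s : ℝ) ^ (r - 1 - j) * (p.choose j : ℝ) = W at *
  generalize ((avoidCount n p F r : ℕ) : ℝ) = a at *
  generalize ((containCount n p F (r - 1) : ℕ) : ℝ) = b at *
  generalize ((p + 1 - r : ℕ) : ℝ) = d at *
  generalize (((n - (p + 1)).choose (k - r) : ℕ) : ℝ) = N at *
  generalize ((p.choose r : ℕ) : ℝ) = c at *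
  generalize ((p.choose (r - 1) : ℕ) : ℝ) = e at *
  generalize f s p r = u at *
  -- Since r·C(p,r) = (p+1-r)·C(p,r-1), scaling by `e` turns the term in u·b into sr times the upper
  -- bound for e·L in `hlow'`.
  have h1 := mul_le_mul_of_nonneg_left hsum hpos1.le
  have h2 : e * (s * ((r : ℝ) * a) + d * (u * b)) =
      (s * r) * (e * a + (s + 1) * W * b) := by
    linear_combination (-(u * b)) * hchoose' + (r : ℝ) * b * hf
  have h3 : e * (e * (d * (s * N))) = (s * r) * (e * (c * N)) := by
    linear_combination (-(s * e * N)) * hchoose'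
  rw [h2, h3] at h1
  have h4 := le_of_mul_le_mul_left h1 (mul_pos hs' hr')
  refine le_of_mul_le_mul_left ?_ hpos1
  linarith

end Counting

/-! ### Comparison with 𝒜_{p,r} outside the heavy sets -/

section Comparison

variable {n k p r : ℕ} {F : Finset (Finset ℕ)}

/-- The sets that meet `[p]` in at least `r` elements, and in more than `r` if they do not
contain `p + 1`. -/
def IsHeavy (p r : ℕ) (A : Finset ℕ) : Prop :=
  r ≤ (A ∩ Icc 1 p).card ∧ ((A ∩ Icc 1 p).card = r → p + 1 ∈ A)

instance (p r : ℕ) : DecidablePred (IsHeavy p r) := fun _ => instDecidableAnd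

theorem Icc_succ_eq_insert (p : ℕ) : Icc 1 (p + 1) = insert (p + 1) (Icc 1 p) := by
  ext x; simp only [mem_Icc, mem_insert]; omega

theorem card_filter_not_isHeavy_le (hF : F ⊆ powersetCard k (Icc 1 n)) :
    (F.filter fun A => ¬ IsHeavy p r A).card ≤
      avoidCount n p F r + ∑ j ∈ range r, (avoidCount n p F j + containCount n p F j) := by
  have hav : ∀ j, ((powersetCard j (Icc 1 p)).biUnion fun Q =>
      F.filter fun A => A ∩ Icc 1 (p + 1) = Q).card ≤ avoidCount n p F j := fun j =>
    card_biUnion_le.trans (le_of_eq (sum_congr rfl fun Q hQ => (card_link hF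
      ((mem_powersetCard.1 hQ).1.trans (Icc_subset_Icc_right (Nat.le_succ p)))).symm))
  have hco : ∀ j, ((powersetCard j (Icc 1 p)).biUnion fun T =>
      F.filter fun A => A ∩ Icc 1 (p + 1) = insert (p + 1) T).card ≤ containCount n p F j :=
    fun j => card_biUnion_le.trans (le_of_eq (sum_congr rfl fun T hT => (card_link hF
      (by rw [Icc_succ_eq_insert]; exact insert_subset_insert _ (mem_powersetCard.1 hT).1)).symm))
  have hsub : (F.filter fun A => ¬ IsHeavy p r A) ⊆
      ((powersetCard r (Icc 1 p)).biUnion fun Q => F.filter fun A => A ∩ Icc 1 (p + 1) = Q) ∪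
      (range r).biUnion fun j =>
        ((powersetCard j (Icc 1 p)).biUnion fun Q => F.filter fun A => A ∩ Icc 1 (p + 1) = Q) ∪
        ((powersetCard j (Icc 1 p)).biUnion fun T =>
          F.filter fun A => A ∩ Icc 1 (p + 1) = insert (p + 1) T) := by
    intro A hA
    obtain ⟨hA, hh⟩ := mem_filter.1 hA
    have h1 : p + 1 ∈ A → A ∩ Icc 1 (p + 1) = insert (p + 1) (A ∩ Icc 1 p) := fun h => by
      rw [Icc_succ_eq_insert, inter_insert_of_mem h]
    have h2 : p + 1 ∉ A → A ∩ Icc 1 (p + 1) = A ∩ Icc 1 p := fun h => by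
      rw [Icc_succ_eq_insert, inter_insert_of_notMem h]
    have h3 : ∀ j, (A ∩ Icc 1 p).card = j → A ∩ Icc 1 p ∈ powersetCard j (Icc 1 p) :=
      fun j hj => mem_powersetCard.2 ⟨inter_subset_right, hj⟩
    rcases lt_or_ge (A ∩ Icc 1 p).card r with hlt | hge
    · refine mem_union_right _ (mem_biUnion.2 ⟨_, mem_range.2 hlt, ?_⟩)
      by_cases hp : p + 1 ∈ A
      · exact mem_union_right _ (mem_biUnion.2 ⟨_, h3 _ rfl, mem_filter.2 ⟨hA, h1 hp⟩⟩)
      · exact mem_union_left _ (mem_biUnion.2 ⟨_, h3 _ rfl, mem_filter.2 ⟨hA, h2 hp⟩⟩)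
    · simp only [IsHeavy, hge, true_and, Classical.not_imp] at hh
      exact mem_union_left _ (mem_biUnion.2 ⟨_, h3 _ hh.1, mem_filter.2 ⟨hA, h2 hh.2⟩⟩)
  refine (card_le_card hsub).trans ((card_union_le _ _).trans (add_le_add (hav r) ?_))
  exact card_biUnion_le.trans (sum_le_sum fun j _ =>
    (card_union_le _ _).trans (add_le_add (hav j) (hco j)))

/-- An r-subset of [p] joined to any k - r elements above p + 1 is such a set, and its trace on [p]
recovers the pair. -/
theorem le_card_frankl_filter_not_isHeavy (hrk : r ≤ k) (hpn : p + 1 ≤ n) :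
    p.choose r * (n - (p + 1)).choose (k - r) ≤
      ((frankl n k p r).filter fun A => ¬ IsHeavy p r A).card := by
  have h1 : (powersetCard r (Icc 1 p) ×ˢ powersetCard (k - r) (Icc (p + 1 + 1) n)).card =
      p.choose r * (n - (p + 1)).choose (k - r) := by
    rw [card_product, card_powersetCard, card_powersetCard, Nat.card_Icc, Nat.card_Icc,
      Nat.add_sub_cancel]
    congr 2
    omega
  rw [← h1]
  have hdis : ∀ Q H : Finset ℕ, Q ⊆ Icc 1 p → H ⊆ Icc (p + 1 + 1) n →
      Disjoint Q H ∧ (Q ∪ H) ∩ Icc 1 p = Q := by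
    intro Q H hQ hH
    have hd : Disjoint (Icc 1 p) H := disjoint_of_subset_left
      (Icc_subset_Icc_right (Nat.le_succ p)) (disjoint_of_subset_Icc Subset.rfl hH)
    refine ⟨disjoint_of_subset_left hQ hd, ?_⟩
    rw [union_inter_distrib_right, inter_eq_left.2 hQ, disjoint_iff_inter_eq_empty.1 hd.symm,
      union_empty]
  refine card_le_card_of_injOn (fun a => a.1 ∪ a.2) ?_ ?_
  · rintro ⟨Q, H⟩ h
    rw [mem_coe, mem_product, mem_powersetCard, mem_powersetCard] at h
    obtain ⟨⟨hQ, hQc⟩, hH, hHc⟩ := h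
    dsimp only at hQ hQc hH hHc
    obtain ⟨hd, he⟩ := hdis Q H hQ hH
    rw [mem_coe, mem_filter, frankl, mem_filter, mem_powersetCard, IsHeavy]
    dsimp only
    rw [he, hQc]
    refine ⟨⟨⟨union_subset (hQ.trans (Icc_subset_Icc_right (by omega)))
      (hH.trans (Icc_subset_Icc_left (by omega))), ?_⟩, le_rfl⟩, ?_⟩
    · rw [card_union_of_disjoint hd, hQc, hHc]; omega
    · rintro ⟨-, hp⟩
      rcases mem_union.1 (hp rfl) with h | h
      · have := mem_Icc.1 (hQ h); omega
      · have := mem_Icc.1 (hH h); omega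
  · rintro ⟨Q, H⟩ h ⟨Q', H'⟩ h' heq
    rw [mem_coe, mem_product, mem_powersetCard, mem_powersetCard] at h h'
    obtain ⟨hd, he⟩ := hdis Q H h.1.1 h.2.1
    obtain ⟨hd', he'⟩ := hdis Q' H' h'.1.1 h'.2.1
    have heq' : Q ∪ H = Q' ∪ H' := heq
    have hQ : Q = Q' := by rw [← he, heq', he']
    subst hQ
    have hH : H = H' := by
      rw [← union_sdiff_cancel_left hd, heq', union_sdiff_cancel_left hd']
    rw [hH]

end Comparison

end UnionFamilies

theorem mainTheorem1 (n k s p r : ℕ) (hr : 1 ≤ r) (hrk : r ≤ k) (hrp : r ≤ p)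
    (hps : p ≤ s + r - 1)
    (F : Finset (Finset ℕ)) (hF : F ⊆ Finset.powersetCard k (Finset.Icc 1 n))
    (hU : UnionFamilies.PropertyU (s + 1) ((k - r) * (s + 1) + p) F)
    (hn : (p : ℝ) + 1 + ((s : ℝ) + UnionFamilies.f s p r) * ((k : ℝ) - (r : ℝ)) ≤ (n : ℝ)) :
    F.card ≤ (UnionFamilies.frankl n k p r).card := by
  obtain ⟨F', hF', hU', hcard, hS⟩ := UnionFamilies.exists_shifted hF hU
  rw [← hcard]
  have hf := UnionFamilies.le_f hr hrp hps
  have hkr : ((k - r : ℕ) : ℝ) = (k : ℝ) - r := Nat.cast_sub hrk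
  rw [← hkr] at hn
  have hs0 : (0 : ℝ) ≤ s := Nat.cast_nonneg s
  have hnonneg : 0 ≤ ((s : ℝ) + UnionFamilies.f s p r) * ((k - r : ℕ) : ℝ) :=
    mul_nonneg (by linarith) (Nat.cast_nonneg _)
  have hpn : p + 1 ≤ n := by
    have : (p : ℝ) + 1 ≤ n := by linarith
    exact_mod_cast this
  have hn' : ((s : ℝ) + UnionFamilies.f s p r) * ((k - r : ℕ) : ℝ) ≤
      ((n - (p + 1) : ℕ) : ℝ) := by
    rw [Nat.cast_sub hpn]
    push_cast
    linarith
  have h1 := UnionFamilies.avoidCount_add_sum_counts_le hr hrk hrp hps hpn hF' hS hU' hn'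
  have h2 := UnionFamilies.card_filter_not_isHeavy_le (p := p) (r := r) hF'
  have h3 := UnionFamilies.le_card_frankl_filter_not_isHeavy (k := k) (r := r) hrk hpn
  have h4 : (F'.filter (UnionFamilies.IsHeavy p r)).card ≤
      ((UnionFamilies.frankl n k p r).filter (UnionFamilies.IsHeavy p r)).card := by
    refine Finset.card_le_card fun A hA => ?_
    rw [Finset.mem_filter] at hA ⊢
    exact ⟨Finset.mem_filter.2 ⟨hF' hA.1, hA.2.1⟩, hA.2⟩
  rw [← Finset.card_filter_add_card_filter_not (s := F') (UnionFamilies.IsHeavy p r),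
    ← Finset.card_filter_add_card_filter_not (s := UnionFamilies.frankl n k p r)
      (UnionFamilies.IsHeavy p r)]
  exact add_le_add h4 (h2.trans (h1.trans h3))
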